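/- All spaces consist of (real or complex) measurable functions on $(0,\infty)$ with Lebesgue measure $m$, modulo equality almost everywhere. For $0<p\le\infty$, $L_p$ is the usual Lebesgue space with its (quasi-)norm; $L_0$ is the space of functions whose support has finite measure, with $\|f\|_{0}=m(\operatorname{supp} f)$. A quasi-Banach function space is a linear space $E$ of measurable functions with a complete quasi-norm $\|\cdot\|_E$ such that $f\in E$, $g$ measurable and $|g|\le|f|$ a.e. imply $g\in E$ and $\|g\|_E\le\|f\|_E$. A linear operator $T:L_p+L_q\to L_p+L_q$ is bounded on the couple $(L_p,L_q)$ if there is a constant $C$ such that for $r\in\{p,q\}$ and all $f\in L_r$ we have $Tf\in L_r$ and $\|Tf\|_{r}\le C\|f\|_{r}$. We write $E\in\mathrm{Int}(L_p,L_q)$ if $L_p\cap L_q\subset E\subset L_p+L_q$ and every operator $T$ bounded on $(L_p,L_q)$ maps $E$ to $E$ and is bounded there, i.e. $\|Tf\|_E\le C_T\|f\|_E$ for all $f\in E$ and some constant $C_T$ depending on $T$. Let $\mu(t,f)=\inf\{\lambda\ge0: m(\{|f|>\lambda\})\le t\}$, $t>0$, be the decreasing rearrangement of $f$. Write $g\prec\prec_{\mathrm{hd}}f$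 if $\int_0^t\mu(s,g)\,ds\le\int_0^t\mu(s,f)\,ds$ for all $t>0$, and $g\prec\prec_{\mathrm{tl}}f$ if $\int_t^\infty\mu(s,g)\,ds\le\int_t^\infty\mu(s,f)\,ds$ for all $t>0$. **Theorem.** Let $0\le p<q\le\infty$ and let $E$ be a quasi-Banach function space with $E\in\mathrm{Int}(L_p,L_q)$. Then there exist constants $c_{p,E},c_{q,E}>0$ such that: (i) if $p\ne0$: for all $f\in E$ and $g\in L_p+L_\infty$ with $|g|^p\prec\prec_{\mathrm{hd}}|f|^p$, we have $g\in E$ and $\|g\|_E\le c_{p,E}\|f\|_E$; (ii) if $q\ne\infty$: for all $f\in E$ and $g\in L_0+L_q$ with $|g|^q\prec\prec_{\mathrm{tl}}|f|^q$, we have $g\in E$ and $\|g\|_E\le c_{q,E}\|f\|_E$. -/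

import Mathlib

open MeasureTheory Set Filter Topology
open scoped ENNReal

noncomputable section

/-- Lebesgue measure on the half line `(0, ∞)`. -/
abbrev halfLine : Measure ℝ := volume.restrict (Ioi (0 : ℝ))

/-- The linear space `𝒳` of all measurable scalar functions on `(0, ∞)`, modulo equality
almost everywhere. -/
abbrev MeasFun (𝕜 : Type*) [RCLike 𝕜] := ℝ →ₘ[halfLine] 𝕜

/-- A linear space of measurable functions on `(0, ∞)` with a real-valued functional measuring the
size of its elements (a quasi-norm, or `f ↦ m (supp f)` in the case of `L_0`). The values of `size`
outside of `carrier` are irrelevant. -/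
structure SizedSpace (𝕜 : Type*) [RCLike 𝕜] where
  carrier : Submodule 𝕜 (MeasFun 𝕜)
  size : MeasFun 𝕜 → ℝ

/-- A quasi-Banach function space: a linear space of measurable functions with a complete quasi-norm
`size` which is solid. -/
structure QuasiBanachFunctionSpace (𝕜 : Type*) [RCLike 𝕜] extends SizedSpace 𝕜 where
  size_nonneg : ∀ f ∈ carrier, 0 ≤ size f
  size_eq_zero_iff : ∀ f ∈ carrier, size f = 0 ↔ f = 0
  size_smul : ∀ (a : 𝕜), ∀ f ∈ carrier, size (a • f) = ‖a‖ * size f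
  size_add_le : ∃ C : ℝ, ∀ f ∈ carrier, ∀ g ∈ carrier, size (f + g) ≤ C * (size f + size g)
  complete : ∀ u : ℕ → MeasFun 𝕜, (∀ n, u n ∈ carrier) →
    (∀ ε : ℝ, 0 < ε → ∃ N : ℕ, ∀ m ≥ N, ∀ n ≥ N, size (u m - u n) < ε) →
    ∃ f ∈ carrier, Tendsto (fun n => size (u n - f)) atTop (𝓝 0)
  solid : ∀ f ∈ carrier, ∀ g : MeasFun 𝕜, (∀ᵐ x ∂halfLine, ‖g x‖ ≤ ‖f x‖) →
    g ∈ carrier ∧ size g ≤ size f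

/-- `L_0`: the functions whose support has finite measure, with `‖f‖_0 = m (supp f)`. -/
def Lzero (𝕜 : Type*) [RCLike 𝕜] : SizedSpace 𝕜 where
  carrier :=
    { carrier := {f | halfLine {x | f x ≠ 0} < ∞}
      zero_mem' := by
        have h : halfLine {x | (0 : MeasFun 𝕜) x ≠ 0} = 0 := by
          have := AEEqFun.coeFn_zero (μ := halfLine) (α := ℝ) (β := 𝕜)
          exact ae_iff.1 this
        simp only [mem_ofPred_eq, h, ENNReal.zero_lt_top]
      add_mem' := by
        intro f g hf hg
        refine lt_of_le_of_lt (measure_mono_ae ?_)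
          (lt_of_le_of_lt (measure_union_le {x | f x ≠ 0} {x | g x ≠ 0})
            (ENNReal.add_lt_top.2 ⟨hf, hg⟩))
        filter_upwards [AEEqFun.coeFn_add f g] with x hx hne
        by_contra hcon
        have h1 : f x = 0 := by
          by_contra h
          exact hcon (Or.inl h)
        have h2 : g x = 0 := by
          by_contra h
          exact hcon (Or.inr h)
        apply hne
        rw [hx, Pi.add_apply, h1, h2, add_zero]
      smul_mem' := by
        intro a f hf
        refine lt_of_le_of_lt (measure_mono_ae ?_) hf
        filter_upwards [AEEqFun.coeFn_smul a f] with x hx hne h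
        apply hne
        rw [hx, Pi.smul_apply, h, smul_zero] }
  size f := (halfLine {x | f x ≠ 0}).toReal

/-- The space `L_p` on `(0, ∞)`, for `p ∈ [0, ∞]`. -/
def LSpace (𝕜 : Type*) [RCLike 𝕜] (p : ℝ≥0∞) : SizedSpace 𝕜 :=
  if p = 0 then Lzero 𝕜
  else
    { carrier := Lp.LpSubmodule 𝕜 𝕜 p halfLine
      size := fun f => (eLpNorm f p halfLine).toReal }

/-- The linear operator `T`, defined on a space `V` of functions, restricts to a bounded operator
`A → A`, where `A ⊆ V`. -/
def RestrictsBounded {𝕜 : Type*} [RCLike 𝕜] {V : Submodule 𝕜 (MeasFun 𝕜)} (T : V →ₗ[𝕜] V)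
    (A : SizedSpace 𝕜) : Prop :=
  ∃ C : ℝ, ∀ f : V, (f : MeasFun 𝕜) ∈ A.carrier →
    (T f : MeasFun 𝕜) ∈ A.carrier ∧ A.size (T f) ≤ C * A.size f

/-- `T : A + B → A + B` is bounded on the couple `(A, B)`. -/
def BoundedOnCouple {𝕜 : Type*} [RCLike 𝕜] (A B : SizedSpace 𝕜)
    (T : ↥(A.carrier ⊔ B.carrier) →ₗ[𝕜] ↥(A.carrier ⊔ B.carrier)) : Prop :=
  RestrictsBounded T A ∧ RestrictsBounded T B

/-- `E` is an interpolation space for the couple `(A, B)`. -/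
def IsInterpolationSpace {𝕜 : Type*} [RCLike 𝕜] (A B E : SizedSpace 𝕜) : Prop :=
  A.carrier ⊓ B.carrier ≤ E.carrier ∧ E.carrier ≤ A.carrier ⊔ B.carrier ∧
    ∀ T : ↥(A.carrier ⊔ B.carrier) →ₗ[𝕜] ↥(A.carrier ⊔ B.carrier),
      BoundedOnCouple A B T → RestrictsBounded T E

/-- The right-continuous decreasing rearrangement
`μ(t, F) = inf {l ≥ 0 : m {F > l} ≤ t}` of a nonnegative function `F` on `(0, ∞)`. -/
def rearrangement (F : ℝ → ℝ≥0∞) (t : ℝ) : ℝ≥0∞ :=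
  sInf {l : ℝ≥0∞ | halfLine {x | l < F x} ≤ ENNReal.ofReal t}

/-- Head majorization `G ≺≺_hd F`. -/
def HeadMajorized (G F : ℝ → ℝ≥0∞) : Prop :=
  ∀ t : ℝ, 0 < t →
    ∫⁻ s in Ioo 0 t, rearrangement G s ≤ ∫⁻ s in Ioo 0 t, rearrangement F s

/-- Tail majorization `G ≺≺_tl F`. -/
def TailMajorized (G F : ℝ → ℝ≥0∞) : Prop :=
  ∀ t : ℝ, 0 < t →
    ∫⁻ s in Ioi t, rearrangement G s ≤ ∫⁻ s in Ioi t, rearrangement F s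

/-- The function `|f|^r`. -/
def absPow {𝕜 : Type*} [RCLike 𝕜] (f : MeasFun 𝕜) (r : ℝ) : ℝ → ℝ≥0∞ :=
  fun x => ‖f x‖ₑ ^ r

end

/-! Each majorization is converted into a splitting of the half line into A and its complement, on
each of which g equals w · (f ∘ φ) for a weighted composition operator that is bounded on `L_p` and
on `L_q` with constants depending only on p and q. The interpolation property then puts both pieces
of g in E, and the quasi-triangle inequality adds them.

Such an operator is bounded on `L_r` as soon as φ pushes |w|^r dx to at most C dx
(`WeightedComp.Bound`; for r = 0 the density is the indicator of the support of w). For w = g / (f ∘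
φ) it suffices that φ carries |g|^r dx into C |f|^r dx (`ratio_bound`). A bound at one exponent
passes to larger exponents if |w| is bounded above, and to smaller ones if |w| ≥ 1 on its support.

The maps φ come from monotone transport on the line: if one measure is dominated by another on all
upper level sets, it can be moved into the other without lowering the level
(`exists_transport_of_levels`). Majorization supplies the domination at dyadic levels. Head case,
with G = |g|^p and F = |f|^p: the mass of G above 2a is at most twice the mass of F above a, so G dx
moves into 2F dx with G ≤ 4 F ∘ φ. This fails only at low levels where F has infinite mass; there F
has values of comparable size on a set of infinite measure, and the half line is mapped onto that
set preserving measure, which is a bound at exponent 0. Tail case, with G = |g|^q and F = |f|^q: at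
each level either the mass of G below is controlled by that of F, or the measure of the set above
is. The first kind of level gives a transport of mass with |w| ≥ 1 and a bound at q; the second
gives a transport of Lebesgue measure with bounded w and a bound at 0.

The operators depend on f and g, while interpolation only yields a constant for each operator.
Uniformity (`exists_uniform_bound`) is a gluing argument: a sequence of operators violating it,
placed on disjoint copies of the half line, forms one operator bounded on the couple but not on E.
-/

/-! ### Monotone transport of measures on the line -/

/-- A measure assigning at most `b - a` to each interval `(a, b]` is bounded by Lebesgue measure. -/
theorem le_volume_of_Ioc_le (ρ : Measure ℝ)
    (h : ∀ a b : ℝ, ρ (Ioc a b) ≤ ENNReal.ofReal (b - a)) : ρ ≤ volume := by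
  refine Measure.le_iff.2 fun s hs => ?_
  have key : ρ.toOuterMeasure ≤ StieltjesFunction.id.outer := by
    refine OuterMeasure.le_ofFunction.2 fun t => ?_
    rw [StieltjesFunction.length]
    split_ifs
    · exact (IsEmpty.false (0 : ℝ)).elim
    refine le_iInf fun a => le_iInf fun b => le_iInf fun hab => ?_
    refine (measure_mono (fun x hx => ?_)).trans (h a b)
    exact hab ⟨hx, fun hb => not_isBot x hb⟩
  rw [Real.volume_eq_stieltjes_id]
  rw [StieltjesFunction.measure]
  exact key s

/-- The distribution function of a measure on the line. -/
noncomputable def distFun (μ : Measure ℝ) (x : ℝ) : ℝ := (μ (Iic x)).toReal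

theorem distFun_mono {μ : Measure ℝ} (hμ : ∀ x, μ (Iic x) ≠ ∞) : Monotone (distFun μ) :=
  fun _ b hab => ENNReal.toReal_mono (hμ b) (measure_mono (Iic_subset_Iic.2 hab))

theorem isLocallyFiniteMeasure_of_Iic {μ : Measure ℝ} (hμ : ∀ x, μ (Iic x) ≠ ∞) :
    IsLocallyFiniteMeasure μ :=
  ⟨fun x => ⟨Iic (x + 1), Iic_mem_nhds (by linarith), (hμ _).lt_top⟩⟩

theorem measure_Ioc_eq_ofReal_distFun {μ : Measure ℝ} (hμ : ∀ x, μ (Iic x) ≠ ∞) {a b : ℝ}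
    (hab : a ≤ b) : μ (Ioc a b) = ENNReal.ofReal (distFun μ b - distFun μ a) := by
  rw [← Iic_sdiff_Iic, measure_sdiff (Iic_subset_Iic.2 hab) measurableSet_Iic.nullMeasurableSet (hμ a),
    distFun, distFun, ENNReal.ofReal_sub _ ENNReal.toReal_nonneg, ENNReal.ofReal_toReal (hμ _),
    ENNReal.ofReal_toReal (hμ _)]

/-- The distribution function of an atomless measure pushes it to a measure bounded by
Lebesgue measure. -/
theorem map_distFun_le {μ : Measure ℝ} [NullSingletonClass μ] (hμ : ∀ x, μ (Iic x) ≠ ∞) :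
    μ.map (distFun μ) ≤ volume := by
  have hmono := distFun_mono hμ
  have := isLocallyFiniteMeasure_of_Iic hμ
  refine le_volume_of_Ioc_le _ fun a b => ?_
  have hm : MeasurableSet (distFun μ ⁻¹' Ioc a b) := hmono.measurable measurableSet_Ioc
  -- The preimage is order convex but may lack endpoints; inner regularity replaces it by compact
  -- sets, which have a least and a greatest element.
  rw [Measure.map_apply hmono.measurable measurableSet_Ioc, hm.measure_eq_iSup_isCompact]
  refine iSup_le fun K => iSup_le fun hK => iSup_le fun hc => ?_
  rcases K.eq_empty_or_nonempty with rfl | hne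
  · simp
  obtain ⟨x, hx⟩ := hc.exists_isLeast hne
  obtain ⟨y, hy⟩ := hc.exists_isGreatest hne
  have hxy : x ≤ y := hx.2 hy.1
  calc μ K ≤ μ (Icc x y) := measure_mono fun z hz => ⟨hx.2 hz, hy.2 hz⟩
    _ = μ (Ioc x y) := (Ioc_ae_eq_Icc (μ := μ)).measure_eq.symm
    _ = ENNReal.ofReal (distFun μ y - distFun μ x) := measure_Ioc_eq_ofReal_distFun hμ hxy
    _ ≤ _ := ENNReal.ofReal_le_ofReal (by linarith [(hK hx.1).1, (hK hy.1).2])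

open Classical in
/-- The quantile function of a measure on the line. -/
noncomputable def quantile (ν : Measure ℝ) (s : ℝ) : ℝ :=
  if 0 < s ∧ ENNReal.ofReal s < ν univ then sInf {y | s ≤ distFun ν y} else 0

/-- The strict bounds on `s` make the set whose infimum is taken nonempty and bounded below, and
right continuity of the distribution function makes the infimum attained. This Galois connection is
the only property of `quantile` used on its effective range. -/
theorem quantile_le_iff {ν : Measure ℝ} (hν : ∀ x, ν (Iic x) ≠ ∞) {s : ℝ}
    (hs : 0 < s ∧ ENNReal.ofReal s < ν univ) (y : ℝ) : quantile ν s ≤ y ↔ s ≤ distFun ν y := by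
  have hne : {y | s ≤ distFun ν y}.Nonempty := by
    obtain ⟨z, hz⟩ := ((tendsto_order.1 (tendsto_measure_Iic_atTop ν)).1 _ hs.2).exists
    exact ⟨z, (ENNReal.ofReal_le_iff_le_toReal (hν z)).1 hz.le⟩
  have hinter : Tendsto (fun x => ν (Iic x)) atBot (𝓝 0) := by
    have := tendsto_measure_iInter_atBot (μ := ν) (s := fun x : ℝ => Iic x)
      (fun _ => measurableSet_Iic.nullMeasurableSet) (fun a b hab => Iic_subset_Iic.2 hab)
      ⟨0, hν 0⟩
    have h0 : (⋂ x : ℝ, Iic x) = ∅ := by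
      rw [iInter_Iic_eq_empty_iff]
      simp
    rw [h0, measure_empty] at this
    exact this
  have hbdd : BddBelow {y | s ≤ distFun ν y} := by
    obtain ⟨z, hz⟩ := ((tendsto_order.1 hinter).2 (ENNReal.ofReal s) (by simpa using hs.1)).exists
    refine ⟨z, fun w hw => ?_⟩
    by_contra! hlt
    have h1 : ENNReal.ofReal s ≤ ν (Iic w) := (ENNReal.ofReal_le_iff_le_toReal (hν w)).2 hw
    exact absurd (h1.trans (measure_mono (Iic_subset_Iic.2 hlt.le))) (not_le.2 hz)
  have hright : s ≤ distFun ν (sInf {y | s ≤ distFun ν y}) := by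
    set z := sInf {y | s ≤ distFun ν y}
    have hz : ∀ n : ℕ, ENNReal.ofReal s ≤ ν (Iic (z + 1 / ((n : ℝ) + 1))) := fun n => by
      have hpos : (0 : ℝ) < 1 / ((n : ℝ) + 1) := by positivity
      obtain ⟨w, hw, hwz⟩ := exists_lt_of_csInf_lt hne (show z < z + 1 / ((n : ℝ) + 1) by linarith)
      exact ((ENNReal.ofReal_le_iff_le_toReal (hν w)).2 hw).trans
        (measure_mono (Iic_subset_Iic.2 hwz.le))
    have hI : Iic z = ⋂ n : ℕ, Iic (z + 1 / ((n : ℝ) + 1)) := by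
      ext w
      simp only [mem_Iic, mem_iInter]
      refine ⟨fun h n => h.trans (by have : (0 : ℝ) < 1 / ((n : ℝ) + 1) := by positivity
                                     linarith), fun h => ?_⟩
      by_contra! hlt
      obtain ⟨n, hn⟩ := exists_nat_one_div_lt (sub_pos.2 hlt)
      linarith [h n]
    have hlim := tendsto_measure_iInter_atTop (μ := ν)
      (s := fun n : ℕ => Iic (z + 1 / ((n : ℝ) + 1)))
      (fun _ => measurableSet_Iic.nullMeasurableSet)
      (fun a b hab => Iic_subset_Iic.2 (by
        have := Nat.one_div_le_one_div (α := ℝ) hab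
        linarith)) ⟨0, hν _⟩
    rw [← hI] at hlim
    exact (ENNReal.ofReal_le_iff_le_toReal (hν z)).1 (ge_of_tendsto' hlim hz)
  rw [quantile, if_pos hs]
  exact ⟨fun h => hright.trans (distFun_mono hν h), fun h => csInf_le hbdd h⟩

theorem measurable_quantile {ν : Measure ℝ} (hν : ∀ x, ν (Iic x) ≠ ∞) :
    Measurable (quantile ν) := by
  refine measurable_of_Iic fun y => ?_
  have hP : MeasurableSet {s : ℝ | 0 < s ∧ ENNReal.ofReal s < ν univ} :=
    measurableSet_Ioi.inter (measurableSet_lt ENNReal.measurable_ofReal measurable_const)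
  have : quantile ν ⁻¹' Iic y = ({s : ℝ | 0 < s ∧ ENNReal.ofReal s < ν univ} ∩ Iic (distFun ν y)) ∪
      ({s : ℝ | 0 < s ∧ ENNReal.ofReal s < ν univ}ᶜ ∩ {_s | 0 ≤ y}) := by
    ext s
    by_cases hs : 0 < s ∧ ENNReal.ofReal s < ν univ
    · have := quantile_le_iff hν hs y
      simp only [mem_preimage, mem_Iic, mem_union, mem_inter_iff, mem_ofPred_eq, mem_compl_iff, hs,
        not_true, this, true_and, false_and, or_false, and_self]
    · have h0 : quantile ν s = 0 := if_neg hs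
      simp only [mem_preimage, mem_Iic, mem_union, mem_inter_iff, mem_ofPred_eq, mem_compl_iff, hs,
        not_false_iff, h0, true_and, false_and, false_or]
  rw [this]
  exact (hP.inter measurableSet_Iic).union (hP.compl.inter (MeasurableSet.const _))

/-- The quantile function pushes Lebesgue measure to the original measure. -/
theorem map_quantile_eq {ν : Measure ℝ} (hν : ∀ x, ν (Iic x) ≠ ∞) :
    (volume.restrict {s : ℝ | 0 < s ∧ ENNReal.ofReal s < ν univ}).map (quantile ν) = ν := by
  have := isLocallyFiniteMeasure_of_Iic hν
  symm
  refine Measure.ext_of_Ioc _ _ fun a b hab => ?_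
  have hq := measurable_quantile hν
  have hset : quantile ν ⁻¹' Ioc a b ∩ {s : ℝ | 0 < s ∧ ENNReal.ofReal s < ν univ} =
      Ioc (distFun ν a) (distFun ν b) ∩ {s : ℝ | 0 < s ∧ ENNReal.ofReal s < ν univ} := by
    ext s
    simp only [mem_inter_iff, mem_preimage, mem_Ioc]
    refine and_congr_left fun hs => ?_
    rw [← not_le, quantile_le_iff hν hs, quantile_le_iff hν hs, not_le]
  have hP : MeasurableSet {s : ℝ | 0 < s ∧ ENNReal.ofReal s < ν univ} :=
    measurableSet_Ioi.inter (measurableSet_lt ENNReal.measurable_ofReal measurable_const)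
  rw [Measure.map_apply hq measurableSet_Ioc, Measure.restrict_apply (hq measurableSet_Ioc), hset,
    measure_Ioc_eq_ofReal_distFun hν hab.le]
  -- Only the right endpoint can be lost: `distFun ν b` may equal the total mass, where `quantile`
  -- takes its default value.
  have hae : (Ioc (distFun ν a) (distFun ν b) ∩ {s : ℝ | 0 < s ∧ ENNReal.ofReal s < ν univ} : Set ℝ)
      =ᵐ[volume] Ioo (distFun ν a) (distFun ν b) := by
    refine EventuallyEq.trans ?_ Ioo_ae_eq_Ioc.symm
    have hn : ∀ᵐ s : ℝ, s ≠ distFun ν b := by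
      simp [ae_iff]
    filter_upwards [hn] with s hs
    refine propext ⟨fun h => h.1, fun h => ⟨h, lt_of_le_of_lt ENNReal.toReal_nonneg h.1, ?_⟩⟩
    have : s < distFun ν b := lt_of_le_of_ne h.2 hs
    exact ((ENNReal.ofReal_lt_iff_lt_toReal (lt_of_le_of_lt ENNReal.toReal_nonneg h.1).le
      (hν b)).2 this).trans_le (measure_mono (subset_univ _))
  rw [measure_congr hae, Real.volume_Ioo]

/-- Monotone transport between two measures on the line. -/
theorem map_quantile_distFun_le {μ ν : Measure ℝ} [NullSingletonClass μ] (hμ : ∀ x, μ (Iic x) ≠ ∞)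
    (hν : ∀ x, ν (Iic x) ≠ ∞) (h : μ univ ≤ ν univ) :
    (∀ᵐ x ∂μ, 0 < distFun μ x ∧ ENNReal.ofReal (distFun μ x) < ν univ) ∧
      μ.map (quantile ν ∘ distFun μ) ≤ ν := by
  have hm := (distFun_mono hμ).measurable
  have hle := map_distFun_le hμ
  have hP : MeasurableSet {s : ℝ | 0 < s ∧ ENNReal.ofReal s < ν univ} :=
    measurableSet_Ioi.inter (measurableSet_lt ENNReal.measurable_ofReal measurable_const)
  -- The pushforward is dominated by Lebesgue measure, so it has no atoms; this excludes the two
  -- boundary values 0 and the total mass of ν.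
  have hne : ∀ c : ℝ, ∀ᵐ x ∂μ, distFun μ x ≠ c := fun c => by
    have h1 : ∀ᵐ s ∂(μ.map (distFun μ)), s ≠ c := ae_mono hle (show ∀ᵐ s : ℝ, s ≠ c by simp [ae_iff])
    exact ae_of_ae_map hm.aemeasurable h1
  have hae : ∀ᵐ x ∂μ, 0 < distFun μ x ∧ ENNReal.ofReal (distFun μ x) < ν univ := by
    filter_upwards [hne 0, hne (ν univ).toReal] with x h0 h1
    refine ⟨lt_of_le_of_ne ENNReal.toReal_nonneg (Ne.symm h0), ?_⟩
    rw [distFun, ENNReal.ofReal_toReal (hμ x)]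
    refine lt_of_le_of_ne ((measure_mono (subset_univ _)).trans h) fun heq => h1 ?_
    rw [distFun, heq]
  refine ⟨hae, ?_⟩
  rw [← Measure.map_map (measurable_quantile hν) hm]
  conv_rhs => rw [← map_quantile_eq hν]
  refine Measure.map_mono ?_ (measurable_quantile hν)
  have : μ.map (distFun μ) = (μ.map (distFun μ)).restrict
      {s : ℝ | 0 < s ∧ ENNReal.ofReal s < ν univ} := by
    symm
    refine Measure.restrict_eq_self_of_ae_mem ?_
    exact (ae_map_iff hm.aemeasurable hP).2 hae
  rw [this]
  exact Measure.restrict_mono le_rfl hle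

/-! ### Transport respecting integer levels -/

/-- An embedding of the half line into the line which sorts points by decreasing level `κ`, and
points of the same level by their position. -/
noncomputable def levelEmbed (κ : ℝ → ℤ) (x : ℝ) : ℝ := -(κ x : ℝ) + x / (1 + x)

/-- The left inverse of `levelEmbed κ`. -/
noncomputable def levelProj (y : ℝ) : ℝ := Int.fract y / (1 - Int.fract y)

/-- Since x / (1 + x) lies in (0, 1), the integer part records the negated level and the fractional
part the position. Left rays therefore correspond to upper level sets, up to one partial level. -/
theorem levelEmbed_floor {κ : ℝ → ℤ} {x : ℝ} (hx : 0 < x) :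
    ⌊levelEmbed κ x⌋ = -κ x ∧ Int.fract (levelEmbed κ x) = x / (1 + x) := by
  have h1 : 0 < x / (1 + x) := by positivity
  have h2 : x / (1 + x) < 1 := by rw [div_lt_one (by linarith)]; linarith
  have h3 : ⌊levelEmbed κ x⌋ = -κ x := by
    rw [Int.floor_eq_iff, levelEmbed]
    push_cast
    constructor <;> linarith
  refine ⟨h3, ?_⟩
  rw [Int.fract, h3, levelEmbed]
  push_cast
  ring

theorem levelProj_levelEmbed {κ : ℝ → ℤ} {x : ℝ} (hx : 0 < x) :
    levelProj (levelEmbed κ x) = x := by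
  rw [levelProj, (levelEmbed_floor hx).2]
  field_simp
  simp

theorem measurable_levelEmbed {κ : ℝ → ℤ} (hκ : Measurable κ) : Measurable (levelEmbed κ) := by
  have : Measurable fun x => ((κ x : ℤ) : ℝ) := (measurable_from_top (f := fun k : ℤ => (k : ℝ))).comp hκ
  unfold levelEmbed
  fun_prop

theorem measurable_levelProj : Measurable levelProj := by
  unfold levelProj
  fun_prop

/-- If `μ` is dominated by `ν` on all the upper level sets, then `μ` can be transported into `ν`
without decreasing the level. -/
theorem exists_transport_of_levels {μ ν : Measure ℝ} (hμ0 : μ ≪ halfLine) (hν0 : ν ≪ halfLine)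
    {κ l : ℝ → ℤ} (hκ : Measurable κ) (hl : Measurable l)
    (hle : ∀ k, μ {x | k ≤ κ x} ≤ ν {x | k ≤ l x}) (hfin : ∀ k, ν {x | k ≤ l x} ≠ ∞) :
    ∃ φ : ℝ → ℝ, Measurable φ ∧ μ.map φ ≤ ν ∧ ∀ᵐ x ∂μ, κ x ≤ l (φ x) := by
  have hpos : ∀ᵐ x ∂halfLine, 0 < x := ae_restrict_mem measurableSet_Ioi
  have hμp := hμ0.ae_le hpos
  have hνp := hν0.ae_le hpos
  have heκ := measurable_levelEmbed hκ
  have hel := measurable_levelEmbed hl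
  have hdm := measurable_levelProj
  have hcmpμ : ∀ y : ℝ, μ.map (levelEmbed κ) (Iic y) ≤ μ {x | -⌊y⌋ ≤ κ x} := fun y => by
    rw [Measure.map_apply heκ measurableSet_Iic]
    refine measure_mono_ae ?_
    filter_upwards [hμp] with x hx hxy
    have := Int.floor_le_floor (mem_Iic.1 hxy)
    rw [(levelEmbed_floor hx).1] at this
    change -⌊y⌋ ≤ κ x
    linarith
  have hcmpν : ∀ y : ℝ, ν.map (levelEmbed l) (Iic y) ≤ ν {x | -⌊y⌋ ≤ l x} := fun y => by
    rw [Measure.map_apply hel measurableSet_Iic]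
    refine measure_mono_ae ?_
    filter_upwards [hνp] with x hx hxy
    have := Int.floor_le_floor (mem_Iic.1 hxy)
    rw [(levelEmbed_floor hx).1] at this
    change -⌊y⌋ ≤ l x
    linarith
  have hμI : ∀ y, μ.map (levelEmbed κ) (Iic y) ≠ ∞ := fun y =>
    ne_top_of_le_ne_top (hfin _) ((hcmpμ y).trans (hle _))
  have hνI : ∀ y, ν.map (levelEmbed l) (Iic y) ≠ ∞ := fun y =>
    ne_top_of_le_ne_top (hfin _) (hcmpν y)
  have : NullSingletonClass (μ.map (levelEmbed κ)) := ⟨fun y => by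
    rw [Measure.map_apply heκ (measurableSet_singleton y)]
    have h0 : μ {levelProj y} = 0 := hμ0 (by simp)
    refine measure_mono_null_ae ?_ h0
    filter_upwards [hμp] with x hx hxy
    change x = levelProj y
    rw [← mem_singleton_iff.1 hxy, levelProj_levelEmbed hx]⟩
  have huniv : μ.map (levelEmbed κ) univ ≤ ν.map (levelEmbed l) univ := by
    refine le_of_tendsto' (tendsto_measure_Iic_atTop _) fun y => ?_
    refine ((hcmpμ y).trans (hle _)).trans ?_
    rw [Measure.map_apply hel MeasurableSet.univ]
    exact measure_mono (subset_univ _)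
  obtain ⟨hrange, hmap⟩ := map_quantile_distFun_le hμI hνI huniv
  have hQ := (measurable_quantile hνI).comp (distFun_mono hμI).measurable
  refine ⟨levelProj ∘ (quantile (ν.map (levelEmbed l)) ∘ distFun (μ.map (levelEmbed κ))) ∘
    levelEmbed κ, hdm.comp (hQ.comp heκ), ?_, ?_⟩
  · rw [← Measure.map_map hdm (hQ.comp heκ), ← Measure.map_map hQ heκ]
    refine (Measure.map_mono hmap hdm).trans ?_
    rw [Measure.map_map hdm hel, Measure.map_congr (g := id), Measure.map_id]
    filter_upwards [hνp] with x hx using levelProj_levelEmbed hx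
  -- The quantile estimate below only gives an image at most `-κ x + 1`. Almost every image point
  -- has positive fractional part, which rules out that integer and saves the level that would
  -- otherwise be lost.
  · have hP : ∀ᵐ y ∂(ν.map (levelEmbed l)), 0 < Int.fract y ∧ l (levelProj y) = -⌊y⌋ := by
      have hms : MeasurableSet {y : ℝ | 0 < Int.fract y ∧ l (levelProj y) = -⌊y⌋} :=
        (measurableSet_lt measurable_const measurable_fract).inter
          (measurableSet_eq_fun (hl.comp hdm) Int.measurable_floor.neg)
      rw [ae_map_iff hel.aemeasurable hms]
      filter_upwards [hνp] with x hx
      rw [levelProj_levelEmbed hx, (levelEmbed_floor hx).1, (levelEmbed_floor hx).2]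
      exact ⟨by positivity, by simp⟩
    have hP' := ae_of_ae_map heκ.aemeasurable
      (ae_of_ae_map hQ.aemeasurable (ae_mono hmap hP))
    filter_upwards [hP', ae_of_ae_map heκ.aemeasurable hrange, hμp] with x hx hs hx0
    simp only [Function.comp_apply] at hx ⊢
    set s := distFun (μ.map (levelEmbed κ)) (levelEmbed κ x) with hsdef
    have hy : quantile (ν.map (levelEmbed l)) s ≤ -(κ x : ℝ) + 1 := by
      rw [quantile_le_iff hνI hs, hsdef]
      refine ENNReal.toReal_mono (hνI _) ?_
      refine ((hcmpμ _).trans (hle _)).trans ?_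
      rw [(levelEmbed_floor hx0).1, neg_neg, Measure.map_apply hel measurableSet_Iic]
      refine measure_mono_ae ?_
      filter_upwards [hνp] with z hz hzl
      have h1 : ((κ x : ℤ) : ℝ) ≤ l z := by exact_mod_cast hzl
      have h2 : z / (1 + z) < 1 := by rw [div_lt_one (by linarith)]; linarith
      change levelEmbed l z ≤ _
      rw [levelEmbed]
      linarith
    have hfl : ⌊quantile (ν.map (levelEmbed l)) s⌋ < -κ x + 1 := by
      have h1 := Int.floor_add_fract (quantile (ν.map (levelEmbed l)) s)
      have h2 : (⌊quantile (ν.map (levelEmbed l)) s⌋ : ℝ) < ((-κ x + 1 : ℤ) : ℝ) := by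
        push_cast
        linarith [hx.1]
      exact_mod_cast h2
    rw [hx.2]
    omega

/-! ### Layer cake formulas and majorization at a single level -/

theorem volume_setOf_ofReal_lt (y : ℝ≥0∞) :
    volume.restrict (Ioi (0 : ℝ)) {l : ℝ | ENNReal.ofReal l < y} = y := by
  have hm : MeasurableSet {l : ℝ | ENNReal.ofReal l < y} :=
    measurableSet_lt ENNReal.measurable_ofReal measurable_const
  rw [Measure.restrict_apply hm]
  rcases eq_or_ne y ∞ with rfl | hy
  · simp
  · have : {l : ℝ | ENNReal.ofReal l < y} ∩ Ioi 0 = Ioo 0 y.toReal := by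
      ext l
      simp only [mem_inter_iff, mem_ofPred_eq, mem_Ioi, mem_Ioo]
      refine ⟨fun h => ⟨h.2, (ENNReal.ofReal_lt_iff_lt_toReal h.2.le hy).1 h.1⟩,
        fun h => ⟨(ENNReal.ofReal_lt_iff_lt_toReal h.1.le hy).2 h.2, h.1⟩⟩
    rw [this, Real.volume_Ioo, sub_zero, ENNReal.ofReal_toReal hy]

/-- The layer cake formula for extended nonnegative functions. -/
theorem lintegral_eq_lintegral_measure_ofReal_lt {α : Type*} [MeasurableSpace α] (μ : Measure α)
    [SFinite μ] {F : α → ℝ≥0∞} (hF : Measurable F) :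
    ∫⁻ x, F x ∂μ = ∫⁻ l in Ioi (0 : ℝ), μ {x | ENNReal.ofReal l < F x} := by
  have hms : MeasurableSet {z : α × ℝ | ENNReal.ofReal z.2 < F z.1} :=
    measurableSet_lt (ENNReal.measurable_ofReal.comp measurable_snd) (hF.comp measurable_fst)
  calc ∫⁻ x, F x ∂μ
      = ∫⁻ x, (∫⁻ l in Ioi (0 : ℝ),
          {z : α × ℝ | ENNReal.ofReal z.2 < F z.1}.indicator 1 (x, l)) ∂μ := by
        refine lintegral_congr fun x => ?_
        have hm : MeasurableSet {l : ℝ | ENNReal.ofReal l < F x} :=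
          measurableSet_lt ENNReal.measurable_ofReal measurable_const
        conv_lhs => rw [← volume_setOf_ofReal_lt (F x), ← lintegral_indicator_one hm]
        rfl
    _ = ∫⁻ l in Ioi (0 : ℝ), ∫⁻ x,
          {z : α × ℝ | ENNReal.ofReal z.2 < F z.1}.indicator 1 (x, l) ∂μ :=
        lintegral_lintegral_swap
          (f := fun x l => {z : α × ℝ | ENNReal.ofReal z.2 < F z.1}.indicator 1 (x, l))
          (measurable_one.indicator hms).aemeasurable
    _ = _ := by
        refine lintegral_congr fun l => ?_
        have hm : MeasurableSet {x | ENNReal.ofReal l < F x} := measurableSet_lt measurable_const hF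
        rw [← lintegral_indicator_one hm]
        rfl

theorem rearrangement_antitone (F : ℝ → ℝ≥0∞) : Antitone (rearrangement F) := fun _ _ hst =>
  sInf_le_sInf fun _ hl => le_trans hl (ENNReal.ofReal_le_ofReal hst)

/-- The set {F > l} is the increasing union of {F > u n} for u n decreasing to l, so the infimum
defining the rearrangement is attained. -/
theorem lt_rearrangement_iff (F : ℝ → ℝ≥0∞) (l : ℝ≥0∞) (s : ℝ) :
    l < rearrangement F s ↔ ENNReal.ofReal s < halfLine {x | l < F x} := by
  rw [← not_iff_not, not_lt, not_lt]
  refine ⟨fun h => ?_, fun h => sInf_le h⟩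
  rcases eq_or_ne l ∞ with rfl | hl
  · simp
  obtain ⟨u, hanti, hul, hlim⟩ := exists_seq_strictAnti_tendsto' (show l < ∞ from hl.lt_top)
  have hset : {x | l < F x} = ⋃ n, {x | u n < F x} := by
    ext x
    simp only [mem_ofPred_eq, mem_iUnion]
    exact ⟨fun hx => ((tendsto_order.1 hlim).2 _ hx).exists, fun ⟨n, hn⟩ => (hul n).1.trans hn⟩
  have hmono : Monotone fun n => {x | u n < F x} := fun a b hab x hx =>
    lt_of_le_of_lt (hanti.antitone hab) hx
  rw [hset, hmono.measure_iUnion]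
  refine iSup_le fun n => ?_
  obtain ⟨l', hl', hlt⟩ := sInf_lt_iff.1 (lt_of_le_of_lt h (hul n).1)
  exact (measure_mono fun x hx => hlt.trans hx).trans hl'

/-- The region under the rearrangement is sliced horizontally: at height l the slice is (0, m{F >
l}), here cut off at t. The tail formula cuts the same slices to the right of t. -/
theorem lintegral_Ioo_rearrangement (F : ℝ → ℝ≥0∞) (t : ℝ) :
    ∫⁻ s in Ioo 0 t, rearrangement F s =
      ∫⁻ l in Ioi (0 : ℝ), min (ENNReal.ofReal t) (halfLine {x | ENNReal.ofReal l < F x}) := by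
  rw [lintegral_eq_lintegral_measure_ofReal_lt _ (rearrangement_antitone F).measurable]
  refine lintegral_congr fun l => ?_
  simp_rw [lt_rearrangement_iff]
  set M := halfLine {x | ENNReal.ofReal l < F x}
  have hm : MeasurableSet {l : ℝ | ENNReal.ofReal l < M} :=
    measurableSet_lt ENNReal.measurable_ofReal measurable_const
  rw [Measure.restrict_apply hm]
  conv_rhs => rw [← volume_setOf_ofReal_lt (min _ M)]
  rw [Measure.restrict_apply (measurableSet_lt ENNReal.measurable_ofReal measurable_const)]
  congr 1
  ext s
  simp only [mem_inter_iff, mem_ofPred_eq, mem_Ioo, mem_Ioi, lt_min_iff]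
  constructor
  · exact fun h => ⟨⟨(ENNReal.ofReal_lt_ofReal_iff_of_nonneg h.2.1.le).2 h.2.2, h.1⟩, h.2.1⟩
  · exact fun h => ⟨h.1.2, h.2, (ENNReal.ofReal_lt_ofReal_iff_of_nonneg h.2.le).1 h.1.1⟩

theorem lintegral_Ioi_rearrangement (F : ℝ → ℝ≥0∞) {t : ℝ} (ht : 0 < t) :
    ∫⁻ s in Ioi t, rearrangement F s =
      ∫⁻ l in Ioi (0 : ℝ), (halfLine {x | ENNReal.ofReal l < F x} - ENNReal.ofReal t) := by
  rw [lintegral_eq_lintegral_measure_ofReal_lt _ (rearrangement_antitone F).measurable]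
  refine lintegral_congr fun l => ?_
  simp_rw [lt_rearrangement_iff]
  set M := halfLine {x | ENNReal.ofReal l < F x}
  have hm : MeasurableSet {l : ℝ | ENNReal.ofReal l < M} :=
    measurableSet_lt ENNReal.measurable_ofReal measurable_const
  rw [Measure.restrict_apply hm]
  rcases eq_or_ne M ∞ with hM | hM
  · simp [hM]
  · have : {l : ℝ | ENNReal.ofReal l < M} ∩ Ioi t = Ioo t M.toReal := by
      ext s
      simp only [mem_inter_iff, mem_ofPred_eq, mem_Ioi, mem_Ioo]
      refine ⟨fun h => ⟨h.2, (ENNReal.ofReal_lt_iff_lt_toReal (ht.trans h.2).le hM).1 h.1⟩,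
        fun h => ⟨(ENNReal.ofReal_lt_iff_lt_toReal (ht.trans h.1).le hM).2 h.2, h.1⟩⟩
    rw [this, Real.volume_Ioo, ENNReal.ofReal_sub _ ht.le, ENNReal.ofReal_toReal hM]

/-- Head majorization controls the mass above a level by the mass above half the level. -/
theorem HeadMajorized.lintegral_ge_le {G F : ℝ → ℝ≥0∞} (h : HeadMajorized G F)
    (hG : Measurable G) (hF : Measurable F) {a : ℝ} (ha : 0 < a) :
    ∫⁻ x in {x | ENNReal.ofReal (2 * a) ≤ G x}, G x ∂halfLine ≤
      2 * ∫⁻ x in {x | ENNReal.ofReal a ≤ F x}, F x ∂halfLine := by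
  set A := {x | ENNReal.ofReal (2 * a) ≤ G x} with hA
  set B := {x | ENNReal.ofReal a ≤ F x} with hB
  have hAm : MeasurableSet A := measurableSet_le measurable_const hG
  have hBm : MeasurableSet B := measurableSet_le measurable_const hF
  set c := ∫⁻ x in B, F x ∂halfLine with hc
  set d := ∫⁻ x in A, G x ∂halfLine with hd
  set u := halfLine A with hu
  rcases eq_or_ne c ∞ with hctop | hctop
  · rw [hctop]; simp
  -- Heights below a contribute at most a t, and heights above a at most c.
  have hIF : ∀ t : ℝ, ∫⁻ s in Ioo 0 t, rearrangement F s ≤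
      ENNReal.ofReal a * ENNReal.ofReal t + c := fun t => by
    rw [lintegral_Ioo_rearrangement, ← Ioc_union_Ioi_eq_Ioi ha.le]
    refine (lintegral_union_le _ _ _).trans (add_le_add ?_ ?_)
    · calc ∫⁻ l in Ioc 0 a, min (ENNReal.ofReal t) (halfLine {x | ENNReal.ofReal l < F x})
          ≤ ∫⁻ l in Ioc 0 a, ENNReal.ofReal t := lintegral_mono fun l => min_le_left _ _
        _ = _ := by rw [setLIntegral_const, Real.volume_Ioc, sub_zero, mul_comm]
    · rw [hc, lintegral_eq_lintegral_measure_ofReal_lt _ hF]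
      refine (setLIntegral_mono' measurableSet_Ioi fun l hl => ?_).trans
        (lintegral_mono_set (Ioi_subset_Ioi ha.le))
      refine (min_le_right _ _).trans ?_
      rw [Measure.restrict_apply (μ := halfLine) (measurableSet_lt measurable_const hF)]
      exact measure_mono fun x hx =>
        ⟨hx, ((ENNReal.ofReal_le_ofReal (mem_Ioi.1 hl).le).trans_lt hx).le⟩
  have hIG : ∀ t : ℝ, ENNReal.ofReal t ≤ u → ENNReal.ofReal (2 * a) * ENNReal.ofReal t ≤
      ∫⁻ s in Ioo 0 t, rearrangement G s := fun t ht => by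
    rw [lintegral_Ioo_rearrangement]
    calc ENNReal.ofReal (2 * a) * ENNReal.ofReal t
        = ∫⁻ l in Ioo 0 (2 * a), ENNReal.ofReal t := by
          rw [setLIntegral_const, Real.volume_Ioo, sub_zero, mul_comm]
      _ ≤ ∫⁻ l in Ioo 0 (2 * a),
            min (ENNReal.ofReal t) (halfLine {x | ENNReal.ofReal l < G x}) := by
          refine setLIntegral_mono' measurableSet_Ioo fun l hl => le_min le_rfl (ht.trans ?_)
          exact measure_mono fun x hx =>
            ((ENNReal.ofReal_lt_ofReal_iff_of_nonneg hl.1.le).2 hl.2).trans_le hx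
      _ ≤ _ := lintegral_mono_set Ioo_subset_Ioi_self
  have h2a : ENNReal.ofReal (2 * a) = 2 * ENNReal.ofReal a := by
    rw [ENNReal.ofReal_mul zero_le_two]; simp
  -- If u were infinite, then 2at ≤ at + c for every t > 0; the choice t = (c + 1) / a is
  -- contradictory.
  have hut : u ≠ ∞ := fun hutop => by
    have hpos : 0 < (c.toReal + 1) / a := by positivity
    have h1 := ((hIG _ (hutop ▸ le_top)).trans (h _ hpos)).trans (hIF _)
    rw [h2a, mul_assoc, two_mul, ENNReal.add_le_add_iff_left (by finiteness),
      ← ENNReal.ofReal_mul ha.le, mul_div_cancel₀ _ ha.ne', ← ENNReal.ofReal_toReal hctop,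
      ENNReal.ofReal_le_ofReal_iff ENNReal.toReal_nonneg, ENNReal.toReal_ofReal ENNReal.toReal_nonneg] at h1
    linarith
  rcases eq_or_ne u 0 with hu0 | hu0
  · have : d = 0 := setLIntegral_measure_zero _ _ hu0
    rw [this]; exact zero_le
  have hdle : d ≤ ENNReal.ofReal a * u + c := by
    have h1 := (h _ (ENNReal.toReal_pos hu0 hut)).trans (hIF _)
    rw [ENNReal.ofReal_toReal hut] at h1
    refine le_trans ?_ h1
    rw [lintegral_Ioo_rearrangement, hd, lintegral_eq_lintegral_measure_ofReal_lt _ hG,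
      ENNReal.ofReal_toReal hut]
    refine lintegral_mono fun l => ?_
    rw [Measure.restrict_apply (μ := halfLine) (measurableSet_lt measurable_const hG)]
    exact le_min (measure_mono inter_subset_right) (measure_mono inter_subset_left)
  have hdt : d ≠ ∞ := ne_top_of_le_ne_top (by finiteness) hdle
  have hud : 2 * (ENNReal.ofReal a * u) ≤ d := by
    rw [← mul_assoc, ← h2a, hu, ← setLIntegral_const]
    exact setLIntegral_mono' hAm fun x hx => hx
  -- Majorization at t = u gives d ≤ au + c, while G ≥ 2a on A gives 2au ≤ d; doubling the first and
  -- absorbing yields d ≤ 2c.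
  have : d + d ≤ d + 2 * c := by
    calc d + d ≤ (ENNReal.ofReal a * u + c) + (ENNReal.ofReal a * u + c) := add_le_add hdle hdle
      _ = 2 * (ENNReal.ofReal a * u) + 2 * c := by ring
      _ ≤ d + 2 * c := by gcongr
  exact (ENNReal.add_le_add_iff_left hdt).1 this

/-- Tail majorization controls, at each level, either the mass below or the measure above. -/
theorem TailMajorized.lintegral_lt_le_or {G F : ℝ → ℝ≥0∞} (h : TailMajorized G F)
    (hG : Measurable G) (hF : Measurable F) {a : ℝ} (ha : 0 < a) :
    ∫⁻ x in {x | G x < ENNReal.ofReal (2 * a)}, G x ∂halfLine ≤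
        4 * ∫⁻ x in {x | F x < ENNReal.ofReal a}, F x ∂halfLine ∨
      halfLine {x | ENNReal.ofReal a ≤ G x} ≤ 2 * halfLine {x | ENNReal.ofReal a ≤ F x} := by
  refine or_iff_not_imp_right.2 fun hlt => ?_
  rw [not_le] at hlt
  set u := halfLine {x | ENNReal.ofReal a ≤ G x} with hu
  set t := halfLine {x | ENNReal.ofReal a ≤ F x} with ht
  have htu : t < u / 2 := by
    rw [ENNReal.lt_div_iff_mul_lt (Or.inl two_ne_zero) (Or.inl ENNReal.ofNat_ne_top), mul_comm]
    exact hlt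
  -- Tail majorization is applied at t'. Beyond t' the rearrangement of F sees only values below a,
  -- whereas that of G still has at least u / 2 of its points at height a or more. The strict
  -- inequalities make t' positive and finite even if t = 0 or u = ∞.
  obtain ⟨t', htt', ht'u⟩ := exists_between htu
  have ht'top : t' ≠ ∞ := ht'u.ne_top
  have ht'pos : 0 < t'.toReal := ENNReal.toReal_pos (bot_lt_of_lt htt').ne' ht'top
  have hJ := h _ ht'pos
  rw [lintegral_Ioi_rearrangement _ ht'pos, lintegral_Ioi_rearrangement _ ht'pos,
    ENNReal.ofReal_toReal ht'top] at hJ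
  have hJF : ∫⁻ l in Ioi (0 : ℝ), (halfLine {x | ENNReal.ofReal l < F x} - t') ≤
      ∫⁻ x in {x | F x < ENNReal.ofReal a}, F x ∂halfLine := by
    rw [lintegral_eq_lintegral_measure_ofReal_lt _ hF]
    refine lintegral_mono fun l => ?_
    rw [Measure.restrict_apply (μ := halfLine) (measurableSet_lt measurable_const hF), tsub_le_iff_right]
    refine le_trans (le_trans (measure_mono fun x hx => ?_) (measure_union_le _ _))
      (add_le_add (le_refl (halfLine _)) htt'.le)
    rcases lt_or_ge (F x) (ENNReal.ofReal a) with h1 | h1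
    · exact Or.inl ⟨hx, h1⟩
    · exact Or.inr h1
  have hmlow : MeasurableSet {x | G x < ENNReal.ofReal a} := measurableSet_lt hG measurable_const
  have hJG : ∫⁻ x in {x | G x < ENNReal.ofReal a}, G x ∂halfLine + ENNReal.ofReal a * (u / 2) ≤
      ∫⁻ l in Ioi (0 : ℝ), (halfLine {x | ENNReal.ofReal l < G x} - t') := by
    rw [lintegral_eq_lintegral_measure_ofReal_lt _ hG]
    have hsplit : ∫⁻ l in Ioi (0 : ℝ), halfLine.restrict {x | G x < ENNReal.ofReal a}
          {x | ENNReal.ofReal l < G x} ≤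
        ∫⁻ l in Ioo (0 : ℝ) a, halfLine.restrict {x | G x < ENNReal.ofReal a}
          {x | ENNReal.ofReal l < G x} := by
      rw [← Ioo_union_Ici_eq_Ioi ha]
      refine (lintegral_union_le _ _ _).trans ?_
      have hz : ∫⁻ l in Ici a, halfLine.restrict {x | G x < ENNReal.ofReal a}
          {x | ENNReal.ofReal l < G x} = 0 := by
        rw [← nonpos_iff_eq_zero, ← lintegral_zero (μ := volume.restrict (Ici a))]
        refine setLIntegral_mono' measurableSet_Ici fun l hl => ?_
        rw [Measure.restrict_apply (μ := halfLine) (measurableSet_lt measurable_const hG)]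
        refine le_of_eq (measure_mono_null (fun x hx => ?_) (measure_empty (μ := halfLine)))
        exact absurd (hx.1.trans hx.2) (not_lt.2 (ENNReal.ofReal_le_ofReal hl))
      rw [hz, add_zero]
    refine (add_le_add hsplit le_rfl).trans ?_
    have hconst : ENNReal.ofReal a * (u / 2) = ∫⁻ _l in Ioo (0 : ℝ) a, u / 2 := by
      rw [setLIntegral_const, Real.volume_Ioo, sub_zero, mul_comm]
    rw [hconst, ← lintegral_add_right _ measurable_const]
    refine (setLIntegral_mono' measurableSet_Ioo fun l hl => ?_).trans
      (lintegral_mono_set Ioo_subset_Ioi_self)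
    have hla : ENNReal.ofReal l < ENNReal.ofReal a :=
      (ENNReal.ofReal_lt_ofReal_iff_of_nonneg hl.1.le).2 hl.2
    have hsum : halfLine {x | ENNReal.ofReal l < G x} =
        halfLine.restrict {x | G x < ENNReal.ofReal a} {x | ENNReal.ofReal l < G x} + u := by
      rw [Measure.restrict_apply (μ := halfLine) (measurableSet_lt measurable_const hG),
        ← measure_inter_add_sdiff {x | ENNReal.ofReal l < G x} hmlow]
      congr 1
      refine congrArg halfLine ?_
      ext x
      simp only [Set.mem_sdiff, mem_ofPred_eq, not_lt]
      exact ⟨fun hx => hx.2, fun hx => ⟨hla.trans_le hx, hx⟩⟩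
    have hhalf : t' + u / 2 ≤ u := (add_le_add ht'u.le le_rfl).trans (ENNReal.add_halves u).le
    rw [hsum]
    refine ENNReal.le_sub_of_add_le_left ht'top ?_
    rw [add_left_comm]
    gcongr
  have hGle : ∫⁻ x in {x | G x < ENNReal.ofReal (2 * a)}, G x ∂halfLine ≤
      ∫⁻ x in {x | G x < ENNReal.ofReal a}, G x ∂halfLine + ENNReal.ofReal (2 * a) * u := by
    have hsub : {x | G x < ENNReal.ofReal (2 * a)} ⊆ {x | G x < ENNReal.ofReal a} ∪
        ({x | ENNReal.ofReal a ≤ G x} ∩ {x | G x < ENNReal.ofReal (2 * a)}) := fun x hx => by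
      rcases lt_or_ge (G x) (ENNReal.ofReal a) with h1 | h1
      · exact Or.inl h1
      · exact Or.inr ⟨h1, hx⟩
    refine (lintegral_mono_set hsub).trans ((lintegral_union_le _ _ _).trans ?_)
    gcongr
    calc ∫⁻ x in {x | ENNReal.ofReal a ≤ G x} ∩ {x | G x < ENNReal.ofReal (2 * a)}, G x ∂halfLine
        ≤ ∫⁻ x in {x | ENNReal.ofReal a ≤ G x} ∩ {x | G x < ENNReal.ofReal (2 * a)},
            ENNReal.ofReal (2 * a) ∂halfLine :=
          setLIntegral_mono' ((measurableSet_le measurable_const hG).inter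
            (measurableSet_lt hG measurable_const)) fun x hx => (le_of_lt hx.2)
      _ ≤ _ := by
          rw [setLIntegral_const]
          gcongr
          exact measure_mono inter_subset_left
  have h2a : ENNReal.ofReal (2 * a) * u = 4 * (ENNReal.ofReal a * (u / 2)) := by
    rw [ENNReal.ofReal_mul zero_le_two, ENNReal.ofReal_ofNat]
    conv_lhs => rw [← ENNReal.add_halves u]
    ring
  calc _ ≤ _ := hGle
    _ ≤ 4 * (∫⁻ x in {x | G x < ENNReal.ofReal a}, G x ∂halfLine +
          ENNReal.ofReal a * (u / 2)) := by
        rw [h2a, mul_add]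
        gcongr
        exact le_mul_of_one_le_left zero_le (by norm_num)
    _ ≤ _ := by gcongr; exact hJG.trans (hJ.trans hJF)

/-! ### Weighted composition operators on `L_r` and on interpolation spaces -/

/-- The data of a weighted composition operator `f ↦ weight · (f ∘ map)`. -/
structure WeightedComp (𝕜 : Type*) [RCLike 𝕜] where
  weight : ℝ → 𝕜
  map : ℝ → ℝ
  measurable_weight : Measurable weight
  measurable_map : Measurable map

namespace WeightedComp

variable {𝕜 : Type*} [RCLike 𝕜] (S : WeightedComp 𝕜)

/-- The weighted composition operator on classes of functions. -/
noncomputable def apply (f : MeasFun 𝕜) : MeasFun 𝕜 :=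
  AEEqFun.mk (fun x => S.weight x * f (S.map x))
    (S.measurable_weight.stronglyMeasurable.mul
      (f.stronglyMeasurable.comp_measurable S.measurable_map)).aestronglyMeasurable

theorem coeFn_apply (f : MeasFun 𝕜) :
    S.apply f =ᵐ[halfLine] fun x => S.weight x * f (S.map x) :=
  AEEqFun.coeFn_mk _ _

open Classical in
/-- The density `|weight|^r`, understood as `1` on the support of the weight if `r = 0`. -/
noncomputable def density (r : ℝ≥0∞) (x : ℝ) : ℝ≥0∞ :=
  if S.weight x = 0 then 0 else ‖S.weight x‖ₑ ^ r.toReal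

theorem measurable_density (r : ℝ≥0∞) : Measurable (S.density r) :=
  Measurable.ite (S.measurable_weight (measurableSet_singleton 0)) measurable_const
    (S.measurable_weight.enorm.pow_const _)

theorem density_ne_zero {r : ℝ≥0∞} {x : ℝ} (hx : S.weight x ≠ 0) : S.density r x ≠ 0 := by
  rw [density, if_neg hx]
  exact (ENNReal.rpow_pos (by simpa using hx) (by simp)).ne'

/-- The condition for boundedness on `L_r` with constant controlled by `C`. -/
def Bound (r C : ℝ≥0∞) : Prop :=
  if r = ∞ then ∀ x, ‖S.weight x‖ₑ ≤ C
  else ∀ u : ℝ → ℝ≥0∞, Measurable u →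
    ∫⁻ x, S.density r x * u (S.map x) ∂halfLine ≤ C * ∫⁻ x, u x ∂halfLine

/-- The map is nonsingular on the support of the weight. -/
def Nonsingular : Prop :=
  ∀ P : ℝ → Prop, (∀ᵐ x ∂halfLine, P x) → ∀ᵐ x ∂halfLine, S.weight x ≠ 0 → P (S.map x)

variable {S}

/-- Testing the bound on the indicator of a null set shows that the density vanishes almost
everywhere on its preimage. The sup bound used for r = ∞ says nothing about `map`, hence the
exclusion. -/
theorem Bound.nonsingular {r C : ℝ≥0∞} (h : S.Bound r C) (hr : r ≠ ∞) : S.Nonsingular := by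
  intro P hP
  rw [Bound, if_neg hr] at h
  obtain ⟨N, hPN, hN, hN0⟩ := exists_measurable_superset_of_null (ae_iff.1 hP)
  have h0 := h (N.indicator 1) (measurable_one.indicator hN)
  rw [lintegral_indicator_one hN, hN0, mul_zero, nonpos_iff_eq_zero] at h0
  replace h0 := (lintegral_eq_zero_iff (f := fun x => S.density r x * N.indicator 1 (S.map x))
    ((S.measurable_density r).mul ((measurable_one.indicator hN).comp S.measurable_map))).1 h0
  filter_upwards [h0] with x hx hw
  by_contra hcon
  have hxN : S.map x ∈ N := hPN hcon
  simp [indicator_of_mem hxN, S.density_ne_zero hw] at hx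

theorem Nonsingular.apply_eq (h : S.Nonsingular) {f : MeasFun 𝕜} {f' : ℝ → 𝕜}
    (hf : f =ᵐ[halfLine] f') : S.apply f =ᵐ[halfLine] fun x => S.weight x * f' (S.map x) := by
  filter_upwards [S.coeFn_apply f, h _ hf] with x hx hP
  rw [hx]
  by_cases hw : S.weight x = 0
  · simp [hw]
  · rw [hP hw]

theorem Nonsingular.apply_add (h : S.Nonsingular) (f g : MeasFun 𝕜) :
    S.apply (f + g) = S.apply f + S.apply g := by
  refine AEEqFun.ext ?_
  filter_upwards [h.apply_eq (AEEqFun.coeFn_add f g), AEEqFun.coeFn_add (S.apply f) (S.apply g),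
    S.coeFn_apply f, S.coeFn_apply g] with x h1 h2 h3 h4
  rw [h1, h2, Pi.add_apply, Pi.add_apply, h3, h4, mul_add]

theorem Nonsingular.apply_smul (h : S.Nonsingular) (a : 𝕜) (f : MeasFun 𝕜) :
    S.apply (a • f) = a • S.apply f := by
  refine AEEqFun.ext ?_
  filter_upwards [h.apply_eq (AEEqFun.coeFn_smul a f), AEEqFun.coeFn_smul a (S.apply f),
    S.coeFn_apply f] with x h1 h2 h3
  rw [h1, h2, Pi.smul_apply, Pi.smul_apply, h3, smul_eq_mul, smul_eq_mul, mul_left_comm]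

/-- The weighted composition operator as a linear map. -/
noncomputable def Nonsingular.toLinearMap (h : S.Nonsingular) : MeasFun 𝕜 →ₗ[𝕜] MeasFun 𝕜 where
  toFun := S.apply
  map_add' := h.apply_add
  map_smul' := h.apply_smul

theorem Nonsingular.apply_zero (h : S.Nonsingular) : S.apply 0 = 0 := map_zero h.toLinearMap

theorem Nonsingular.apply_sub (h : S.Nonsingular) (f g : MeasFun 𝕜) :
    S.apply (f - g) = S.apply f - S.apply g := map_sub h.toLinearMap f g

theorem Nonsingular.apply_sum (h : S.Nonsingular) (s : Finset ℕ) (v : ℕ → MeasFun 𝕜) :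
    S.apply (∑ n ∈ s, v n) = ∑ n ∈ s, S.apply (v n) := map_sum h.toLinearMap v s

theorem enorm_weight_mul_rpow {r : ℝ≥0∞} (hr : 0 < r.toReal) (x : ℝ) (c : 𝕜) :
    ‖S.weight x * c‖ₑ ^ r.toReal = S.density r x * ‖c‖ₑ ^ r.toReal := by
  rw [enorm_mul, ENNReal.mul_rpow_of_nonneg _ _ hr.le, density]
  split_ifs with h0
  · simp [h0, hr]
  · rfl

end WeightedComp

section LSpace

variable {𝕜 : Type*} [RCLike 𝕜]

theorem mem_LSpace_zero {f : MeasFun 𝕜} :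
    f ∈ (LSpace 𝕜 0).carrier ↔ halfLine {x | f x ≠ 0} < ∞ := by
  rw [LSpace, if_pos rfl]
  rfl

theorem size_LSpace_zero (f : MeasFun 𝕜) :
    (LSpace 𝕜 0).size f = (halfLine {x | f x ≠ 0}).toReal := by
  rw [LSpace, if_pos rfl]
  rfl

theorem mem_LSpace {r : ℝ≥0∞} (hr : r ≠ 0) {f : MeasFun 𝕜} :
    f ∈ (LSpace 𝕜 r).carrier ↔ eLpNorm f r halfLine < ∞ := by
  rw [LSpace, if_neg hr]
  rfl

theorem size_LSpace {r : ℝ≥0∞} (hr : r ≠ 0) (f : MeasFun 𝕜) :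
    (LSpace 𝕜 r).size f = (eLpNorm f r halfLine).toReal := by
  rw [LSpace, if_neg hr]

namespace WeightedComp

variable {S : WeightedComp 𝕜}

theorem Bound.eLpNorm_apply_le {r C : ℝ≥0∞} (h : S.Bound r C) (hns : S.Nonsingular) (hr : r ≠ 0)
    (f : MeasFun 𝕜) :
    eLpNorm (S.apply f) r halfLine ≤ C ^ (if r = ∞ then 1 else 1 / r.toReal) *
      eLpNorm f r halfLine := by
  rw [eLpNorm_congr_ae (S.coeFn_apply f)]
  by_cases hrt : r = ∞
  · rw [Bound, if_pos hrt] at h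
    rw [if_pos hrt, ENNReal.rpow_one, hrt, eLpNorm_exponent_top, eLpNorm_exponent_top]
    refine eLpNormEssSup_le_of_ae_enorm_bound ?_
    filter_upwards [hns _ (enorm_ae_le_eLpNormEssSup f halfLine)] with x hx
    rw [enorm_mul]
    by_cases hw : S.weight x = 0
    · simp [hw]
    · exact mul_le_mul' (h x) (hx hw)
  · rw [Bound, if_neg hrt] at h
    have hr0 : 0 < r.toReal := ENNReal.toReal_pos hr hrt
    rw [if_neg hrt, eLpNorm_eq_lintegral_rpow_enorm_toReal hr hrt,
      eLpNorm_eq_lintegral_rpow_enorm_toReal hr hrt,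
      ← ENNReal.mul_rpow_of_nonneg _ _ (by positivity)]
    refine ENNReal.rpow_le_rpow ?_ (by positivity)
    simp_rw [enorm_weight_mul_rpow hr0]
    exact h (fun x => ‖f x‖ₑ ^ r.toReal) (f.stronglyMeasurable.measurable.enorm.pow_const _)

theorem Bound.measure_support_apply_le {C : ℝ≥0∞} (h : S.Bound 0 C) (f : MeasFun 𝕜) :
    halfLine {x | S.apply f x ≠ 0} ≤ C * halfLine {x | f x ≠ 0} := by
  rw [Bound, if_neg ENNReal.zero_ne_top] at h
  have hm : MeasurableSet {x | f x ≠ 0} :=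
    (f.stronglyMeasurable.measurable (measurableSet_singleton 0)).compl
  have hm' : MeasurableSet {x | S.apply f x ≠ 0} :=
    ((S.apply f).stronglyMeasurable.measurable (measurableSet_singleton 0)).compl
  have h1 := h ({x | f x ≠ 0}.indicator 1) (measurable_one.indicator hm)
  rw [lintegral_indicator_one hm] at h1
  refine le_trans ?_ h1
  rw [← lintegral_indicator_one hm']
  refine lintegral_mono_ae ?_
  filter_upwards [S.coeFn_apply f] with x hx
  by_cases hne : S.apply f x = 0
  · rw [indicator_of_notMem (by simpa using hne)]
    exact zero_le
  · rw [indicator_of_mem (show x ∈ {x | S.apply f x ≠ 0} from hne)]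
    rw [hx] at hne
    rw [indicator_of_mem (show S.map x ∈ {x | f x ≠ 0} from right_ne_zero_of_mul hne), density,
      if_neg (left_ne_zero_of_mul hne)]
    simp

theorem Bound.exists_bound_LSpace {r C : ℝ≥0∞} (h : S.Bound r C) (hC : C ≠ ∞)
    (hns : S.Nonsingular) :
    ∃ K : ℝ, ∀ f ∈ (LSpace 𝕜 r).carrier, S.apply f ∈ (LSpace 𝕜 r).carrier ∧
      (LSpace 𝕜 r).size (S.apply f) ≤ K * (LSpace 𝕜 r).size f := by
  by_cases hr : r = 0
  · subst hr
    refine ⟨C.toReal, fun f hf => ?_⟩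
    rw [mem_LSpace_zero] at hf
    have hlt : C * halfLine {x | f x ≠ 0} < ∞ := ENNReal.mul_lt_top hC.lt_top hf
    rw [mem_LSpace_zero, size_LSpace_zero, size_LSpace_zero, ← ENNReal.toReal_mul]
    exact ⟨(h.measure_support_apply_le f).trans_lt hlt,
      ENNReal.toReal_mono hlt.ne (h.measure_support_apply_le f)⟩
  · have hK : C ^ (if r = ∞ then 1 else 1 / r.toReal) ≠ ∞ :=
      ENNReal.rpow_ne_top_of_nonneg (by split_ifs <;> positivity) hC
    refine ⟨(C ^ (if r = ∞ then 1 else 1 / r.toReal)).toReal, fun f hf => ?_⟩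
    rw [mem_LSpace hr] at hf
    have hlt := ENNReal.mul_lt_top hK.lt_top hf
    rw [mem_LSpace hr, size_LSpace hr, size_LSpace hr, ← ENNReal.toReal_mul]
    exact ⟨(h.eLpNorm_apply_le hns hr f).trans_lt hlt,
      ENNReal.toReal_mono hlt.ne (h.eLpNorm_apply_le hns hr f)⟩

/-- A weighted composition operator which is bounded on `L_p` and on `L_q` is bounded on every
interpolation space. -/
theorem exists_bound_of_isInterpolationSpace {p q C : ℝ≥0∞} (hp : p ≠ ∞) {E : SizedSpace 𝕜}
    (hE : IsInterpolationSpace (LSpace 𝕜 p) (LSpace 𝕜 q) E) (h₁ : S.Bound p C) (h₂ : S.Bound q C)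
    (hC : C ≠ ∞) :
    ∃ K : ℝ, ∀ f ∈ E.carrier, S.apply f ∈ E.carrier ∧ E.size (S.apply f) ≤ K * E.size f := by
  have hns := h₁.nonsingular hp
  obtain ⟨K₁, hK₁⟩ := h₁.exists_bound_LSpace hC hns
  obtain ⟨K₂, hK₂⟩ := h₂.exists_bound_LSpace hC hns
  have hmem : ∀ f ∈ (LSpace 𝕜 p).carrier ⊔ (LSpace 𝕜 q).carrier,
      S.apply f ∈ (LSpace 𝕜 p).carrier ⊔ (LSpace 𝕜 q).carrier := fun f hf => by
    obtain ⟨a, ha, b, hb, rfl⟩ := Submodule.mem_sup.1 hf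
    rw [hns.apply_add]
    exact Submodule.add_mem_sup (hK₁ a ha).1 (hK₂ b hb).1
  let T : ↥((LSpace 𝕜 p).carrier ⊔ (LSpace 𝕜 q).carrier) →ₗ[𝕜]
      ↥((LSpace 𝕜 p).carrier ⊔ (LSpace 𝕜 q).carrier) :=
    { toFun := fun f => ⟨S.apply f, hmem f f.2⟩
      map_add' := fun f g => Subtype.ext (hns.apply_add f g)
      map_smul' := fun a f => Subtype.ext (hns.apply_smul a f) }
  obtain ⟨K, hK⟩ := hE.2.2 T ⟨⟨K₁, fun f hf => hK₁ f hf⟩, ⟨K₂, fun f hf => hK₂ f hf⟩⟩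
  exact ⟨K, fun f hf => hK ⟨f, hE.2.1 hf⟩ hf⟩

end WeightedComp

end LSpace

/-! ### Decomposition of the half line into countably many copies of itself -/

/-- The embedding of the half line onto its `n`-th copy. -/
noncomputable def copyIncl (n : ℕ) (y : ℝ) : ℝ := (Nat.pair n ⌊y⌋₊ : ℝ) + Int.fract y

/-- The index of the copy which contains a point. -/
noncomputable def copyIndex (x : ℝ) : ℕ := (Nat.unpair ⌊x⌋₊).1

/-- The position of a point within its copy. -/
noncomputable def copyPos (x : ℝ) : ℝ := ((Nat.unpair ⌊x⌋₊).2 : ℝ) + Int.fract x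

theorem measurable_copyIncl (n : ℕ) : Measurable (copyIncl n) :=
  ((measurable_from_top (f := fun k : ℕ => (Nat.pair n k : ℝ))).comp Nat.measurable_floor).add
    measurable_fract

theorem measurable_copyIndex : Measurable copyIndex :=
  (measurable_from_top (f := fun k : ℕ => (Nat.unpair k).1)).comp Nat.measurable_floor

theorem measurable_copyPos : Measurable copyPos :=
  ((measurable_from_top (f := fun k : ℕ => ((Nat.unpair k).2 : ℝ))).comp Nat.measurable_floor).add
    measurable_fract

theorem floor_copyIncl (n : ℕ) (y : ℝ) : ⌊copyIncl n y⌋₊ = Nat.pair n ⌊y⌋₊ := by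
  rw [copyIncl, Nat.floor_eq_iff (by have := Int.fract_nonneg y; positivity)]
  constructor <;> linarith [Int.fract_nonneg y, Int.fract_lt_one y]

theorem copyIndex_copyIncl (n : ℕ) (y : ℝ) : copyIndex (copyIncl n y) = n := by
  rw [copyIndex, floor_copyIncl, Nat.unpair_pair]

theorem copyPos_copyIncl (n : ℕ) {y : ℝ} (hy : 0 ≤ y) : copyPos (copyIncl n y) = y := by
  rw [copyPos, floor_copyIncl, Nat.unpair_pair, copyIncl, Int.fract_natCast_add, Int.fract_fract,
    natCast_floor_eq_intCast_floor hy, Int.floor_add_fract]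

theorem lintegral_halfLine_eq_tsum {u : ℝ → ℝ≥0∞} (hu : Measurable u) :
    ∫⁻ x, u x ∂halfLine = ∑' j : ℕ, ∫⁻ t in Ico (0 : ℝ) 1, u (j + t) := by
  have h1 : Ici (0 : ℝ) = ⋃ j : ℕ, Ico (j : ℝ) (j + 1) := by
    ext x
    simp only [mem_Ici, mem_iUnion, mem_Ico]
    exact ⟨fun hx => ⟨⌊x⌋₊, Nat.floor_le hx, Nat.lt_floor_add_one x⟩,
      fun ⟨j, hj, _⟩ => le_trans (Nat.cast_nonneg j) hj⟩
  have hd : Pairwise (Function.onFun Disjoint fun j : ℕ => Ico (j : ℝ) (j + 1)) := fun i j hij => by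
    refine Set.disjoint_left.2 fun x hi hj => hij ?_
    have hx : 0 ≤ x := le_trans (Nat.cast_nonneg i) hi.1
    rw [← (Nat.floor_eq_iff hx).2 hi, ← (Nat.floor_eq_iff hx).2 hj]
  rw [halfLine, restrict_Ioi_eq_restrict_Ici, h1, lintegral_iUnion (fun _ => measurableSet_Ico) hd]
  refine tsum_congr fun j => ?_
  rw [← (measurePreserving_add_left volume (j : ℝ)).setLIntegral_comp_preimage measurableSet_Ico hu]
  congr 2
  ext t
  simp

/-- Both sides sum over unit intervals; the pairing bijection regroups the intervals into copies. -/
theorem lintegral_halfLine_eq_tsum_copyIncl {u : ℝ → ℝ≥0∞} (hu : Measurable u) :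
    ∫⁻ x, u x ∂halfLine = ∑' n : ℕ, ∫⁻ y, u (copyIncl n y) ∂halfLine := by
  have h1 : ∀ n, ∫⁻ y, u (copyIncl n y) ∂halfLine =
      ∑' k : ℕ, ∫⁻ t in Ico (0 : ℝ) 1, u ((Nat.pair n k : ℕ) + t) := fun n => by
    rw [lintegral_halfLine_eq_tsum (u := fun y => u (copyIncl n y)) (hu.comp (measurable_copyIncl n))]
    refine tsum_congr fun k => setLIntegral_congr_fun measurableSet_Ico fun t ht => ?_
    have hfl : ⌊(k : ℝ) + t⌋₊ = k := by
      rw [Nat.floor_eq_iff (by linarith [ht.1, (Nat.cast_nonneg k : (0 : ℝ) ≤ k)])]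
      constructor <;> linarith [ht.1, ht.2]
    simp only [copyIncl, hfl, Int.fract_natCast_add, Int.fract_eq_self.2 ht]
  simp_rw [h1]
  rw [lintegral_halfLine_eq_tsum hu, ← ENNReal.tsum_prod (f := fun n k =>
    ∫⁻ t in Ico (0 : ℝ) 1, u ((Nat.pair n k : ℕ) + t)), ← Nat.pairEquiv.tsum_eq]
  rfl

namespace WeightedComp

variable {𝕜 : Type*} [RCLike 𝕜]

/-- Extension of a function from the half line to its `n`-th copy, by zero elsewhere. -/
noncomputable def toCopy (𝕜 : Type*) [RCLike 𝕜] (n : ℕ) : WeightedComp 𝕜 where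
  weight x := if copyIndex x = n then 1 else 0
  map := copyPos
  measurable_weight := Measurable.ite (measurable_copyIndex (measurableSet_singleton n))
    measurable_const measurable_const
  measurable_map := measurable_copyPos

/-- Restriction of a function to the `n`-th copy of the half line. -/
noncomputable def fromCopy (𝕜 : Type*) [RCLike 𝕜] (n : ℕ) : WeightedComp 𝕜 where
  weight _ := 1
  map := copyIncl n
  measurable_weight := measurable_const
  measurable_map := measurable_copyIncl n

theorem measurable_comp_copy {β : Type*} [MeasurableSpace β] {F : ℕ → ℝ → β}
    (hF : ∀ n, Measurable (F n)) : Measurable fun x => F (copyIndex x) (copyPos x) := by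
  have h : Measurable fun z : ℕ × ℝ => F z.1 z.2 := measurable_from_prod_countable_right hF
  have h' : Measurable fun x => (copyIndex x, copyPos x) :=
    measurable_copyIndex.prodMk measurable_copyPos
  exact Measurable.comp (g := fun z : ℕ × ℝ => F z.1 z.2) h h'

/-- The direct sum of a sequence of weighted composition operators acting on the copies. -/
noncomputable def glue (S : ℕ → WeightedComp 𝕜) : WeightedComp 𝕜 where
  weight x := (S (copyIndex x)).weight (copyPos x)
  map x := copyIncl (copyIndex x) ((S (copyIndex x)).map (copyPos x))
  measurable_weight :=
    measurable_comp_copy (F := fun n => (S n).weight) fun n => (S n).measurable_weight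
  measurable_map :=
    measurable_comp_copy (F := fun n y => copyIncl n ((S n).map y)) fun n =>
      (measurable_copyIncl n).comp (S n).measurable_map

theorem ae_halfLine_pos : ∀ᵐ x ∂halfLine, 0 < x := ae_restrict_mem measurableSet_Ioi

theorem bound_toCopy (n : ℕ) (r : ℝ≥0∞) : (toCopy 𝕜 n).Bound r 1 := by
  rw [Bound]
  split_ifs with hr
  · intro x
    change ‖(if copyIndex x = n then 1 else 0 : 𝕜)‖ₑ ≤ 1
    split_ifs <;> simp
  · intro u hu
    rw [lintegral_halfLine_eq_tsum_copyIncl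
      (u := fun x => (toCopy 𝕜 n).density r x * u ((toCopy 𝕜 n).map x))
      (((toCopy 𝕜 n).measurable_density r).mul (hu.comp (toCopy 𝕜 n).measurable_map)), one_mul, tsum_eq_single n]
    · refine lintegral_mono_ae ?_
      filter_upwards [ae_halfLine_pos] with y hy
      simp [density, toCopy, copyIndex_copyIncl, copyPos_copyIncl n hy.le]
    · intro k hk
      simp [density, toCopy, copyIndex_copyIncl, hk]

theorem bound_fromCopy (n : ℕ) (r : ℝ≥0∞) : (fromCopy 𝕜 n).Bound r 1 := by
  rw [Bound]
  split_ifs with hr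
  · intro x
    simp [fromCopy]
  · intro u hu
    rw [lintegral_halfLine_eq_tsum_copyIncl hu, one_mul]
    refine le_trans (le_of_eq ?_) (ENNReal.le_tsum n)
    simp [density, fromCopy]

/-- Each copy is mapped into itself, so the inequalities for the individual operators add up without
loss in the constant. -/
theorem bound_glue {S : ℕ → WeightedComp 𝕜} {r C : ℝ≥0∞} (h : ∀ n, (S n).Bound r C) :
    (glue S).Bound r C := by
  rw [Bound]
  split_ifs with hr
  · intro x
    have := h (copyIndex x)
    rw [Bound, if_pos hr] at this
    exact this _
  · intro u hu
    rw [lintegral_halfLine_eq_tsum_copyIncl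
      (u := fun x => (glue S).density r x * u ((glue S).map x))
      (((glue S).measurable_density r).mul (hu.comp (glue S).measurable_map)), lintegral_halfLine_eq_tsum_copyIncl hu,
      ← ENNReal.tsum_mul_left]
    refine ENNReal.tsum_le_tsum fun n => ?_
    have hn := h n
    rw [Bound, if_neg hr] at hn
    refine le_trans (le_of_eq (lintegral_congr_ae ?_)) (hn _ (hu.comp (measurable_copyIncl n)))
    filter_upwards [ae_halfLine_pos] with y hy
    simp [density, glue, copyIndex_copyIncl, copyPos_copyIncl n hy.le]

theorem nonsingular_fromCopy (n : ℕ) : (fromCopy 𝕜 n).Nonsingular :=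
  (bound_fromCopy n 0).nonsingular ENNReal.zero_ne_top

theorem fromCopy_toCopy_self (n : ℕ) (f : MeasFun 𝕜) :
    (fromCopy 𝕜 n).apply ((toCopy 𝕜 n).apply f) = f := by
  refine AEEqFun.ext ?_
  filter_upwards [(nonsingular_fromCopy n).apply_eq ((toCopy 𝕜 n).coeFn_apply f),
    ae_halfLine_pos] with x hx hx0
  rw [hx]
  simp [fromCopy, toCopy, copyIndex_copyIncl, copyPos_copyIncl n hx0.le]

theorem fromCopy_toCopy_of_ne {n k : ℕ} (hnk : n ≠ k) (f : MeasFun 𝕜) :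
    (fromCopy 𝕜 n).apply ((toCopy 𝕜 k).apply f) = 0 := by
  refine AEEqFun.ext ?_
  filter_upwards [(nonsingular_fromCopy n).apply_eq ((toCopy 𝕜 k).coeFn_apply f),
    AEEqFun.coeFn_zero (μ := halfLine) (α := ℝ) (β := 𝕜)] with x hx hx0
  rw [hx, hx0]
  simp [fromCopy, toCopy, copyIndex_copyIncl, hnk]

theorem fromCopy_glue {S : ℕ → WeightedComp 𝕜} (hS : ∀ n, (S n).Nonsingular) (n : ℕ)
    (f : MeasFun 𝕜) :
    (fromCopy 𝕜 n).apply ((glue S).apply f) = (S n).apply ((fromCopy 𝕜 n).apply f) := by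
  refine AEEqFun.ext ?_
  filter_upwards [(nonsingular_fromCopy n).apply_eq ((glue S).coeFn_apply f),
    (hS n).apply_eq ((fromCopy 𝕜 n).coeFn_apply f), ae_halfLine_pos] with x h1 h2 hx0
  rw [h1, h2]
  simp [fromCopy, glue, copyIndex_copyIncl, copyPos_copyIncl n hx0.le]

end WeightedComp

/-! ### Uniform boundedness by gluing operators on disjoint copies -/

namespace QuasiBanachFunctionSpace

variable {𝕜 : Type*} [RCLike 𝕜] (E : QuasiBanachFunctionSpace 𝕜)

theorem exists_quasi_triangle : ∃ K : ℝ, 1 ≤ K ∧ ∀ f ∈ E.carrier, ∀ g ∈ E.carrier,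
    E.size (f + g) ≤ K * (E.size f + E.size g) := by
  obtain ⟨C, hC⟩ := E.size_add_le
  refine ⟨max C 1, le_max_right _ _, fun f hf g hg => (hC f hf g hg).trans ?_⟩
  exact mul_le_mul_of_nonneg_right (le_max_left _ _)
    (add_nonneg (E.size_nonneg f hf) (E.size_nonneg g hg))

theorem size_neg {f : MeasFun 𝕜} (hf : f ∈ E.carrier) : E.size (-f) = E.size f := by
  rw [show -f = (-1 : 𝕜) • f from (neg_one_smul 𝕜 f).symm, E.size_smul _ _ hf]
  simp

theorem size_zero : E.size 0 = 0 := (E.size_eq_zero_iff 0 E.carrier.zero_mem).2 rfl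

/-- A series with rapidly decreasing terms converges. -/
theorem exists_tendsto_sum {K : ℝ} (hK : 1 ≤ K)
    (htri : ∀ f ∈ E.carrier, ∀ g ∈ E.carrier, E.size (f + g) ≤ K * (E.size f + E.size g))
    {v : ℕ → MeasFun 𝕜} (hv : ∀ n, v n ∈ E.carrier)
    (hsize : ∀ n, E.size (v n) ≤ ((2 * K)⁻¹) ^ n) :
    ∃ f ∈ E.carrier,
      Tendsto (fun N => E.size (∑ n ∈ Finset.range N, v n - f)) atTop (𝓝 0) := by
  have hKpos : 0 < K := by linarith
  have hmem : ∀ s : Finset ℕ, ∑ n ∈ s, v n ∈ E.carrier := fun s =>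
    Submodule.sum_mem _ fun n _ => hv n
  -- This bound reproduces itself when the first term is split off: K (2K ρ^(M+1) + ρ^M) = 2K ρ^M
  -- for ρ = (2K)⁻¹.
  have htail : ∀ d M, E.size (∑ i ∈ Finset.range d, v (M + i)) ≤ 2 * K * ((2 * K)⁻¹) ^ M := by
    intro d
    induction d with
    | zero =>
      intro M
      rw [Finset.range_zero, Finset.sum_empty, E.size_zero]
      positivity
    | succ d ih =>
      intro M
      rw [Finset.sum_range_succ']
      have hm : ∑ i ∈ Finset.range d, v (M + (i + 1)) ∈ E.carrier :=
        Submodule.sum_mem _ fun n _ => hv _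
      have h1 := ih (M + 1)
      have h2 : ∀ i, v (M + 1 + i) = v (M + (i + 1)) := fun i => by congr 1; omega
      simp_rw [h2] at h1
      refine (htri _ hm _ (hv _)).trans ?_
      calc K * (E.size (∑ i ∈ Finset.range d, v (M + (i + 1))) + E.size (v (M + 0)))
          ≤ K * (2 * K * ((2 * K)⁻¹) ^ (M + 1) + ((2 * K)⁻¹) ^ M) := by
            gcongr
            exact hsize _
        _ = 2 * K * ((2 * K)⁻¹) ^ M := by
            rw [pow_succ]
            field_simp
            ring
  have hlim : Tendsto (fun M : ℕ => 2 * K * ((2 * K)⁻¹) ^ M) atTop (𝓝 0) := by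
    have : Tendsto (fun M : ℕ => ((2 * K)⁻¹) ^ M) atTop (𝓝 0) :=
      tendsto_pow_atTop_nhds_zero_of_lt_one (by positivity) (inv_lt_one_of_one_lt₀ (by linarith))
    simpa using this.const_mul (2 * K)
  refine E.complete _ (fun N => hmem _) fun ε hε => ?_
  obtain ⟨N, hN⟩ := eventually_atTop.1 ((tendsto_order.1 hlim).2 ε hε)
  have hone : ∀ m ≥ N, ∀ n ≥ m, E.size (∑ i ∈ Finset.range n, v i - ∑ i ∈ Finset.range m, v i) < ε := by
    intro m hm n hn
    obtain ⟨d, rfl⟩ := Nat.exists_eq_add_of_le hn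
    rw [Finset.sum_range_add, add_sub_cancel_left]
    exact (htail d m).trans_lt (hN m hm)
  refine ⟨N, fun m hm n hn => ?_⟩
  rcases le_total m n with h | h
  · rw [← neg_sub, E.size_neg (E.carrier.sub_mem (hmem _) (hmem _))]
    exact hone m hm n h
  · exact hone n hn m h

open WeightedComp in
/-- Weighted composition operators with uniform bounds on `L_p` and `L_q` are uniformly bounded on
an interpolation space. -/
theorem exists_uniform_bound {p q C : ℝ≥0∞} (hp : p ≠ ∞)
    (hE : IsInterpolationSpace (LSpace 𝕜 p) (LSpace 𝕜 q) E.toSizedSpace) (hC : C ≠ ∞) :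
    ∃ K : ℝ, 0 < K ∧ ∀ S : WeightedComp 𝕜, S.Bound p C → S.Bound q C → ∀ f ∈ E.carrier,
      S.apply f ∈ E.carrier ∧ E.size (S.apply f) ≤ K * E.size f := by
  obtain ⟨K, hK, htri⟩ := E.exists_quasi_triangle
  have hKpos : 0 < K := by linarith
  have hincl : ∀ n, ∃ c : ℝ, 0 < c ∧ ∀ f ∈ E.carrier, (toCopy 𝕜 n).apply f ∈ E.carrier ∧
      E.size ((toCopy 𝕜 n).apply f) ≤ c * E.size f := fun n => by
    obtain ⟨c, hc⟩ := exists_bound_of_isInterpolationSpace hp hE (bound_toCopy n p)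
      (bound_toCopy n q) ENNReal.one_ne_top
    refine ⟨max c 1, by positivity, fun f hf => ⟨(hc f hf).1, (hc f hf).2.trans ?_⟩⟩
    exact mul_le_mul_of_nonneg_right (le_max_left _ _) (E.size_nonneg f hf)
  have hrestr : ∀ n, ∃ c : ℝ, 0 < c ∧ ∀ f ∈ E.carrier, (fromCopy 𝕜 n).apply f ∈ E.carrier ∧
      E.size ((fromCopy 𝕜 n).apply f) ≤ c * E.size f := fun n => by
    obtain ⟨c, hc⟩ := exists_bound_of_isInterpolationSpace hp hE (bound_fromCopy n p)
      (bound_fromCopy n q) ENNReal.one_ne_top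
    refine ⟨max c 1, by positivity, fun f hf => ⟨(hc f hf).1, (hc f hf).2.trans ?_⟩⟩
    exact mul_le_mul_of_nonneg_right (le_max_left _ _) (E.size_nonneg f hf)
  choose c hc0 hc using hincl
  choose d hd0 hd using hrestr
  by_contra! hcon
  -- ε n is the size given to the n-th bad function before it is placed on its copy; dividing by c n
  -- makes the series of copies converge.
  let ε : ℕ → ℝ := fun n => ((2 * K)⁻¹) ^ n / c n
  have hε : ∀ n, 0 < ε n := fun n => div_pos (by positivity) (hc0 n)
  -- The factor is chosen so that, after rescaling f to size ε n and paying d n for restriction to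
  -- the copy, a lower bound n + 1 remains.
  have hbad : ∀ n : ℕ, ∃ S : WeightedComp 𝕜, ∃ f : MeasFun 𝕜, S.Bound p C ∧ S.Bound q C ∧
      f ∈ E.carrier ∧ (S.apply f ∈ E.carrier → ((n + 1) * d n / ε n) * E.size f <
        E.size (S.apply f)) := fun n => by
    obtain ⟨S, h1, h2, f, hf, h3⟩ := hcon ((n + 1) * d n / ε n)
      (div_pos (mul_pos (by positivity) (hd0 n)) (hε n))
    exact ⟨S, f, h1, h2, hf, h3⟩
  choose S f hSp hSq hf hbad using hbad
  have hns : ∀ n, (S n).Nonsingular := fun n => (hSp n).nonsingular hp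
  have hf0 : ∀ n, 0 < E.size (f n) := fun n => by
    refine lt_of_le_of_ne (E.size_nonneg _ (hf n)) fun h0 => ?_
    have hfz := (E.size_eq_zero_iff _ (hf n)).1 h0.symm
    have hz : (S n).apply (f n) = 0 := by
      rw [hfz, (hns n).apply_zero]
    have := hbad n (hz ▸ E.carrier.zero_mem)
    rw [hz, hfz, E.size_zero, mul_zero] at this
    exact lt_irrefl _ this
  let a : ℕ → ℝ := fun n => ε n / E.size (f n)
  have ha : ∀ n, 0 < a n := fun n => div_pos (hε n) (hf0 n)
  have hnorm : ∀ n, ‖((a n : ℝ) : 𝕜)‖ = a n := fun n => by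
    rw [RCLike.norm_ofReal, abs_of_pos (ha n)]
  let v : ℕ → MeasFun 𝕜 := fun n => (toCopy 𝕜 n).apply ((a n : 𝕜) • f n)
  have hv : ∀ n, v n ∈ E.carrier := fun n => (hc n _ (E.carrier.smul_mem _ (hf n))).1
  have hvs : ∀ n, E.size (v n) ≤ ((2 * K)⁻¹) ^ n := fun n => by
    refine (hc n _ (E.carrier.smul_mem _ (hf n))).2.trans (le_of_eq ?_)
    rw [E.size_smul _ _ (hf n), hnorm]
    have h1 := (hf0 n).ne'
    have h2 := (hc0 n).ne'
    simp only [a, ε]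
    field_simp
  obtain ⟨F, hF, hlim⟩ := E.exists_tendsto_sum hK htri hv hvs
  have hsum : ∀ N, ∑ n ∈ Finset.range N, v n ∈ E.carrier := fun N =>
    Submodule.sum_mem _ fun n _ => hv n
  have hlin : ∀ n N, n < N →
      (fromCopy 𝕜 n).apply (∑ k ∈ Finset.range N, v k) = (a n : 𝕜) • f n := fun n N hn => by
    rw [(nonsingular_fromCopy n).apply_sum, Finset.sum_eq_single n]
    · exact fromCopy_toCopy_self n _
    · exact fun k _ hk => fromCopy_toCopy_of_ne hk.symm _
    · intro h
      exact absurd (Finset.mem_range.2 hn) h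
  -- The restriction of F is identified through boundedness of `fromCopy` on E, so no pointwise or
  -- in-measure convergence of the series is needed.
  have hFn : ∀ n, (fromCopy 𝕜 n).apply F = (a n : 𝕜) • f n := fun n => by
    have hmem : (a n : 𝕜) • f n - (fromCopy 𝕜 n).apply F ∈ E.carrier :=
      E.carrier.sub_mem (E.carrier.smul_mem _ (hf n)) (hd n F hF).1
    have h0 : E.size ((a n : 𝕜) • f n - (fromCopy 𝕜 n).apply F) ≤ 0 := by
      have hl : Tendsto (fun N => d n * E.size (∑ k ∈ Finset.range N, v k - F)) atTop (𝓝 0) := by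
        simpa using hlim.const_mul (d n)
      refine ge_of_tendsto hl ?_
      filter_upwards [eventually_gt_atTop n] with N hN
      have h1 := (hd n _ (E.carrier.sub_mem (hsum N) hF)).2
      rw [(nonsingular_fromCopy n).apply_sub, hlin n N hN] at h1
      exact h1
    have := (E.size_eq_zero_iff _ hmem).1 (le_antisymm h0 (E.size_nonneg _ hmem))
    exact (sub_eq_zero.1 this).symm
  obtain ⟨c', hc'⟩ := exists_bound_of_isInterpolationSpace hp hE (bound_glue hSp)
    (bound_glue hSq) hC
  have hTF := (hc' F hF).1
  obtain ⟨n, hn⟩ := exists_nat_gt (E.size ((glue S).apply F))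
  have hTn := hd n _ hTF
  rw [fromCopy_glue hns, hFn, (hns n).apply_smul] at hTn
  have hane : (a n : 𝕜) ≠ 0 := by
    rw [Ne, ← norm_eq_zero, hnorm]
    exact (ha n).ne'
  have hmem : (S n).apply (f n) ∈ E.carrier := (E.carrier.smul_mem_iff hane).1 hTn.1
  have h1 := hbad n hmem
  have h2 := hTn.2
  rw [E.size_smul _ _ hmem, hnorm] at h2
  have h3 : a n * (((n + 1) * d n / ε n) * E.size (f n)) = (n + 1) * d n := by
    have h1 := (hf0 n).ne'
    have h2 := (hε n).ne'
    simp only [a]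
    field_simp
  have h4 := mul_lt_mul_of_pos_left h1 (ha n)
  rw [h3] at h4
  have h5 : ((n : ℝ) + 1) * d n < E.size ((glue S).apply F) * d n := by
    rw [mul_comm _ (d n), mul_comm _ (d n)] at *
    linarith
  have h6 := lt_of_mul_lt_mul_right h5 (hd0 n).le
  linarith

end QuasiBanachFunctionSpace

/-! ### Finiteness of truncated integrals for functions in `L_p + L_q` -/

section Finiteness

variable {𝕜 : Type*} [RCLike 𝕜]

theorem lintegral_enorm_rpow_lt_top {r : ℝ≥0∞} (hr0 : r ≠ 0) (hr : r ≠ ∞) {f : MeasFun 𝕜}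
    (hf : f ∈ (LSpace 𝕜 r).carrier) : ∫⁻ x, ‖f x‖ₑ ^ r.toReal ∂halfLine < ∞ :=
  lintegral_rpow_enorm_lt_top_of_eLpNorm_lt_top hr0 hr ((mem_LSpace hr0).1 hf)

theorem measure_enorm_ge_lt_top {r : ℝ≥0∞} (hr : r ≠ ∞) {f : MeasFun 𝕜}
    (hf : f ∈ (LSpace 𝕜 r).carrier) {c : ℝ≥0∞} (hc : c ≠ 0) :
    halfLine {x | c ≤ ‖f x‖ₑ} < ∞ := by
  by_cases hr0 : r = 0
  · subst hr0
    refine (measure_mono fun x hx => ?_).trans_lt (mem_LSpace_zero.1 hf)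
    intro h0
    have hx' : c ≤ ‖f x‖ₑ := hx
    rw [h0, enorm_zero, nonpos_iff_eq_zero] at hx'
    exact hc hx'
  · refine lt_of_le_of_lt (measure_mono fun x hx => ?_)
      (lt_of_le_of_lt (meas_ge_le_lintegral_div (μ := halfLine)
        (f := fun x => ‖f x‖ₑ ^ r.toReal) (ε := (min c 1) ^ r.toReal)
        (f.stronglyMeasurable.measurable.enorm.pow_const _).aemeasurable ?_ ?_)
        (ENNReal.div_lt_top (lintegral_enorm_rpow_lt_top hr0 hr hf).ne ?_))
    · exact ENNReal.rpow_le_rpow ((min_le_left _ _).trans hx) ENNReal.toReal_nonneg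
    · exact (ENNReal.rpow_pos (by simpa [pos_iff_ne_zero] using hc) (by simp)).ne'
    · exact ENNReal.rpow_ne_top_of_nonneg ENNReal.toReal_nonneg (by simp)
    · exact (ENNReal.rpow_pos (by simpa [pos_iff_ne_zero] using hc) (by simp)).ne'

theorem exists_add_enorm_le {A B : SizedSpace 𝕜} {f : MeasFun 𝕜} (hf : f ∈ A.carrier ⊔ B.carrier) :
    ∃ a ∈ A.carrier, ∃ b ∈ B.carrier,
      ∀ᵐ x ∂halfLine, ‖f x‖ₑ ≤ 2 * ‖a x‖ₑ ∨ ‖f x‖ₑ ≤ 2 * ‖b x‖ₑ := by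
  obtain ⟨a, ha, b, hb, rfl⟩ := Submodule.mem_sup.1 hf
  refine ⟨a, ha, b, hb, ?_⟩
  filter_upwards [AEEqFun.coeFn_add a b] with x hx
  rw [hx, Pi.add_apply]
  rcases le_total ‖a x‖ₑ ‖b x‖ₑ with h | h
  · right
    rw [two_mul]
    exact (enorm_add_le _ _).trans (by gcongr)
  · left
    rw [two_mul]
    exact (enorm_add_le _ _).trans (by gcongr)

/-- The larger summand dominates up to a factor 2. Where it is the `L_q` part, high values satisfy
|f|^p ≤ (2|b|)^q; for q = ∞ a level above the bound of that part excludes this case. -/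
theorem exists_lintegral_absPow_ge_lt_top {p q : ℝ≥0∞} (hpq : p < q) (hp : p ≠ 0) {f : MeasFun 𝕜}
    (hf : f ∈ (LSpace 𝕜 p).carrier ⊔ (LSpace 𝕜 q).carrier) :
    ∃ t : ℝ, ∫⁻ x in {x | ENNReal.ofReal t ≤ absPow f p.toReal x}, absPow f p.toReal x ∂halfLine
      < ∞ := by
  obtain ⟨a, ha, b, hb, hab⟩ := exists_add_enorm_le hf
  have hpt := hpq.ne_top
  have hp0 : 0 < p.toReal := ENNReal.toReal_pos hp hpt
  have hfm : Measurable (absPow f p.toReal) := f.stronglyMeasurable.measurable.enorm.pow_const _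
  have ham : Measurable fun x => (2 * ‖a x‖ₑ) ^ p.toReal :=
    (a.stronglyMeasurable.measurable.enorm.const_mul _).pow_const _
  have hia : ∫⁻ x, (2 * ‖a x‖ₑ) ^ p.toReal ∂halfLine < ∞ := by
    simp_rw [ENNReal.mul_rpow_of_nonneg _ _ hp0.le]
    rw [lintegral_const_mul _ (a.stronglyMeasurable.measurable.enorm.pow_const _)]
    exact ENNReal.mul_lt_top (by finiteness) (lintegral_enorm_rpow_lt_top hp hpt ha)
  have hq0 : q ≠ 0 := hpq.ne_bot
  by_cases hq : q = ∞
  · subst hq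
    have hM := (mem_LSpace hq0).1 hb
    rw [eLpNorm_exponent_top] at hM
    set M := eLpNormEssSup b halfLine
    have h2M : 2 * M ≠ ∞ := ENNReal.mul_ne_top ENNReal.ofNat_ne_top hM.ne
    have htop : (2 * M + 1) ^ p.toReal ≠ ∞ := ENNReal.rpow_ne_top_of_nonneg hp0.le
      (ENNReal.add_ne_top.2 ⟨h2M, ENNReal.one_ne_top⟩)
    refine ⟨((2 * M + 1) ^ p.toReal).toReal, lt_of_le_of_lt ?_ hia⟩
    rw [ENNReal.ofReal_toReal htop]
    refine (setLIntegral_mono_ae' (measurableSet_le measurable_const hfm) ?_).trans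
      (setLIntegral_le_lintegral _ _)
    filter_upwards [hab, enorm_ae_le_eLpNormEssSup b halfLine] with x hx hbM hge
    rcases hx with hx | hx
    · exact ENNReal.rpow_le_rpow hx hp0.le
    · exfalso
      have h1 : 2 * M + 1 ≤ ‖f x‖ₑ := (ENNReal.rpow_le_rpow_iff hp0).1 hge
      have h2 : 2 * M + 1 ≤ 2 * M := h1.trans (hx.trans (by gcongr))
      exact absurd (ENNReal.lt_add_right h2M one_ne_zero) (not_lt.2 h2)
  · have hq0' : 0 < q.toReal := ENNReal.toReal_pos hq0 hq
    have hib : ∫⁻ x, (2 * ‖b x‖ₑ) ^ q.toReal ∂halfLine < ∞ := by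
      simp_rw [ENNReal.mul_rpow_of_nonneg _ _ hq0'.le]
      rw [lintegral_const_mul _ (b.stronglyMeasurable.measurable.enorm.pow_const _)]
      exact ENNReal.mul_lt_top (by finiteness) (lintegral_enorm_rpow_lt_top hq0 hq hb)
    refine ⟨1, lt_of_le_of_lt ?_ (ENNReal.add_lt_top.2 ⟨hia, hib⟩)⟩
    rw [ENNReal.ofReal_one, ← lintegral_add_left ham]
    refine (setLIntegral_mono_ae' (measurableSet_le measurable_const hfm) ?_).trans
      (setLIntegral_le_lintegral _ _)
    filter_upwards [hab] with x hx hge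
    rcases hx with hx | hx
    · exact (ENNReal.rpow_le_rpow hx hp0.le).trans le_self_add
    · have h1 : 1 ≤ ‖f x‖ₑ := by
        have : (1 : ℝ≥0∞) ^ p.toReal ≤ ‖f x‖ₑ ^ p.toReal := by rw [ENNReal.one_rpow]; exact hge
        exact (ENNReal.rpow_le_rpow_iff hp0).1 this
      calc ‖f x‖ₑ ^ p.toReal ≤ (2 * ‖b x‖ₑ) ^ p.toReal := ENNReal.rpow_le_rpow hx hp0.le
        _ ≤ (2 * ‖b x‖ₑ) ^ q.toReal :=
          ENNReal.rpow_le_rpow_of_exponent_le (h1.trans hx) (ENNReal.toReal_mono hq hpq.le)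
        _ ≤ _ := le_add_self

theorem measure_absPow_ge_lt_top {p q : ℝ≥0∞} (hpq : p < q) (hq : q ≠ ∞) {f : MeasFun 𝕜}
    (hf : f ∈ (LSpace 𝕜 p).carrier ⊔ (LSpace 𝕜 q).carrier) {t : ℝ} (ht : 0 < t) :
    halfLine {x | ENNReal.ofReal t ≤ absPow f q.toReal x} < ∞ := by
  obtain ⟨a, ha, b, hb, hab⟩ := exists_add_enorm_le hf
  have hq0' : 0 < q.toReal := ENNReal.toReal_pos hpq.ne_bot hq
  set c := ENNReal.ofReal t ^ (1 / q.toReal) / 2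
  have hc : c ≠ 0 := by
    refine (ENNReal.div_pos (ENNReal.rpow_pos (by simpa using ht) (by simp)).ne' (by simp)).ne'
  refine lt_of_le_of_lt (measure_mono_ae ?_) (lt_of_le_of_lt
    (measure_union_le {x | c ≤ ‖a x‖ₑ} {x | c ≤ ‖b x‖ₑ}) (ENNReal.add_lt_top.2
      ⟨measure_enorm_ge_lt_top hpq.ne_top ha hc, measure_enorm_ge_lt_top hq hb hc⟩))
  filter_upwards [hab] with x hx hge
  have h1 : ENNReal.ofReal t ^ (1 / q.toReal) ≤ ‖f x‖ₑ := by
    rw [one_div, ENNReal.rpow_inv_le_iff hq0']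
    exact hge
  rcases hx with hx | hx
  · exact Or.inl (ENNReal.div_le_of_le_mul' (h1.trans hx))
  · exact Or.inr (ENNReal.div_le_of_le_mul' (h1.trans hx))

/-- Where the `L_p` part dominates, |f| ≤ τ gives |f|^q ≤ τ^(q-p) |f|^p. For p = 0 the bound t on a
support of finite measure plays this role. -/
theorem lintegral_absPow_lt_lt_top {p q : ℝ≥0∞} (hpq : p < q) (hq : q ≠ ∞) {f : MeasFun 𝕜}
    (hf : f ∈ (LSpace 𝕜 p).carrier ⊔ (LSpace 𝕜 q).carrier) (t : ℝ) :
    ∫⁻ x in {x | absPow f q.toReal x < ENNReal.ofReal t}, absPow f q.toReal x ∂halfLine < ∞ := by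
  obtain ⟨a, ha, b, hb, hab⟩ := exists_add_enorm_le hf
  have hq0 : q ≠ 0 := hpq.ne_bot
  have hpt := hpq.ne_top
  have hq0' : 0 < q.toReal := ENNReal.toReal_pos hq0 hq
  have hfm : Measurable (absPow f q.toReal) := f.stronglyMeasurable.measurable.enorm.pow_const _
  have hbm : Measurable fun x => (2 * ‖b x‖ₑ) ^ q.toReal :=
    (b.stronglyMeasurable.measurable.enorm.const_mul _).pow_const _
  have hib : ∫⁻ x, (2 * ‖b x‖ₑ) ^ q.toReal ∂halfLine < ∞ := by
    simp_rw [ENNReal.mul_rpow_of_nonneg _ _ hq0'.le]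
    rw [lintegral_const_mul _ (b.stronglyMeasurable.measurable.enorm.pow_const _)]
    exact ENNReal.mul_lt_top (by finiteness) (lintegral_enorm_rpow_lt_top hq0 hq hb)
  by_cases hp : p = 0
  · subst hp
    have hsm : MeasurableSet {x | a x ≠ 0} :=
      (a.stronglyMeasurable.measurable (measurableSet_singleton 0)).compl
    have hia : ∫⁻ x, {x | a x ≠ 0}.indicator (fun _ => ENNReal.ofReal t) x ∂halfLine < ∞ := by
      rw [lintegral_indicator_const hsm]
      exact ENNReal.mul_lt_top ENNReal.ofReal_lt_top (mem_LSpace_zero.1 ha)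
    refine lt_of_le_of_lt ?_ (ENNReal.add_lt_top.2 ⟨hib, hia⟩)
    rw [← lintegral_add_left hbm]
    refine (setLIntegral_mono_ae' (measurableSet_lt hfm measurable_const) ?_).trans
      (setLIntegral_le_lintegral _ _)
    filter_upwards [hab] with x hx hlt
    rcases hx with hx | hx
    · by_cases h0 : a x = 0
      · rw [h0, enorm_zero, mul_zero, nonpos_iff_eq_zero] at hx
        rw [absPow, hx, ENNReal.zero_rpow_of_pos hq0']
        exact zero_le
      · rw [indicator_of_mem (show x ∈ {x | a x ≠ 0} from h0)]
        exact (le_of_lt hlt).trans le_add_self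
    · exact (ENNReal.rpow_le_rpow hx hq0'.le).trans le_self_add
  · have hp0 : 0 < p.toReal := ENNReal.toReal_pos hp hpt
    have hpq' : p.toReal ≤ q.toReal := ENNReal.toReal_mono hq hpq.le
    set τ := ENNReal.ofReal t ^ (1 / q.toReal) with hτ
    have hτt : τ ≠ ∞ := by finiteness
    have hia : ∫⁻ x, τ ^ (q.toReal - p.toReal) * (2 * ‖a x‖ₑ) ^ p.toReal ∂halfLine < ∞ := by
      simp_rw [ENNReal.mul_rpow_of_nonneg _ _ hp0.le]
      rw [lintegral_const_mul _ ((a.stronglyMeasurable.measurable.enorm.pow_const _).const_mul _),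
        lintegral_const_mul _ (a.stronglyMeasurable.measurable.enorm.pow_const _)]
      refine ENNReal.mul_lt_top
        (ENNReal.rpow_lt_top_of_nonneg (sub_nonneg.2 hpq') hτt) (ENNReal.mul_lt_top
        (by finiteness) (lintegral_enorm_rpow_lt_top hp hpt ha))
    refine lt_of_le_of_lt ?_ (ENNReal.add_lt_top.2 ⟨hib, hia⟩)
    rw [← lintegral_add_left hbm]
    refine (setLIntegral_mono_ae' (measurableSet_lt hfm measurable_const) ?_).trans
      (setLIntegral_le_lintegral _ _)
    filter_upwards [hab] with x hx hlt
    rcases hx with hx | hx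
    · refine le_trans ?_ le_add_self
      have h1 : ‖f x‖ₑ ≤ τ := by
        rw [hτ, one_div, ENNReal.le_rpow_inv_iff hq0']
        exact le_of_lt hlt
      calc ‖f x‖ₑ ^ q.toReal = ‖f x‖ₑ ^ (q.toReal - p.toReal) * ‖f x‖ₑ ^ p.toReal := by
            rw [← ENNReal.rpow_add_of_nonneg _ _ (sub_nonneg.2 hpq') hp0.le, sub_add_cancel]
        _ ≤ _ := mul_le_mul' (ENNReal.rpow_le_rpow h1 (sub_nonneg.2 hpq'))
            (ENNReal.rpow_le_rpow hx hp0.le)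
    · exact (ENNReal.rpow_le_rpow hx hq0'.le).trans le_self_add

end Finiteness

/-! ### Dyadic levels and operators sending f to g -/

/-- The dyadic level of a nonnegative function. -/
theorem exists_dyadic_level {F : ℝ → ℝ≥0∞} (hF : Measurable F) :
    ∃ κ : ℝ → ℤ, Measurable κ ∧ ∀ x, F x ≠ 0 → F x ≠ ∞ →
      ∀ k : ℤ, k ≤ κ x ↔ ENNReal.ofReal ((2 : ℝ) ^ k) ≤ F x := by
  -- At values 0 and ∞ of F this is the default level 0, so later arguments treat the zero set
  -- separately.
  refine ⟨fun x => ⌊Real.logb 2 (F x).toReal⌋,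
    Int.measurable_floor.comp ((Real.measurable_log.comp hF.ennreal_toReal).div_const _),
    fun x h0 ht k => ?_⟩
  rw [Int.le_floor, Real.le_logb_iff_rpow_le one_lt_two (ENNReal.toReal_pos h0 ht),
    Real.rpow_intCast, ENNReal.ofReal_le_iff_le_toReal ht]

namespace WeightedComp

variable {𝕜 : Type*} [RCLike 𝕜] {S : WeightedComp 𝕜}

theorem Bound.mono {r C C' : ℝ≥0∞} (h : S.Bound r C) (hC : C ≤ C') : S.Bound r C' := by
  rw [Bound] at h ⊢
  split_ifs at h ⊢
  · exact fun x => (h x).trans hC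
  · exact fun u hu => (h u hu).trans (by gcongr)

/-- On the support of the weight, |w|^r' ≤ M^(r'-r) |w|^r. The maximum with M covers r' = ∞. -/
theorem Bound.of_le_exponent {r r' C M : ℝ≥0∞} (h : S.Bound r C) (hr : r ≠ ∞) (hrr : r ≤ r')
    (hM : ∀ x, ‖S.weight x‖ₑ ≤ M) :
    S.Bound r' (max M (M ^ (r'.toReal - r.toReal) * C)) := by
  by_cases hr' : r' = ∞
  · rw [Bound, if_pos hr']
    exact fun x => (hM x).trans (le_max_left _ _)
  · refine Bound.mono ?_ (le_max_right _ _)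
    have hsub : 0 ≤ r'.toReal - r.toReal := sub_nonneg.2 (ENNReal.toReal_mono hr' hrr)
    rw [Bound, if_neg hr] at h
    rw [Bound, if_neg hr']
    intro u hu
    rw [mul_assoc]
    refine le_trans ?_ (mul_le_mul_right (h u hu) _)
    rw [← lintegral_const_mul (f := fun x => S.density r x * u (S.map x)) _
      ((S.measurable_density r).mul (hu.comp S.measurable_map))]
    refine lintegral_mono fun x => ?_
    rw [← mul_assoc]
    gcongr
    rw [density, density]
    split_ifs
    · simp
    · rw [← sub_add_cancel r'.toReal r.toReal,
        ENNReal.rpow_add_of_nonneg _ _ hsub ENNReal.toReal_nonneg, add_sub_cancel_right]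
      gcongr
      exact hM x

/-- Where |w| ≥ 1, lowering the exponent lowers |w|^r. -/
theorem Bound.of_ge_exponent {r r' C : ℝ≥0∞} (h : S.Bound r' C) (hr' : r' ≠ ∞) (hrr : r ≤ r')
    (hM : ∀ x, S.weight x ≠ 0 → 1 ≤ ‖S.weight x‖ₑ) : S.Bound r C := by
  rw [Bound, if_neg hr'] at h
  rw [Bound, if_neg (ne_top_of_le_ne_top hr' hrr)]
  refine fun u hu => le_trans (lintegral_mono fun x => ?_) (h u hu)
  gcongr
  rw [density, density]
  split_ifs with h0
  · exact le_rfl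
  · exact ENNReal.rpow_le_rpow_of_exponent_le (hM x h0) (ENNReal.toReal_mono hr' hrr)

/-- The operator which sends `f` to `g` on the set `A`. -/
noncomputable def ratio (f g : MeasFun 𝕜) {A : Set ℝ} (hA : MeasurableSet A) {φ : ℝ → ℝ}
    (hφ : Measurable φ) : WeightedComp 𝕜 where
  weight := A.indicator fun x => g x / f (φ x)
  map := φ
  measurable_weight := (g.stronglyMeasurable.measurable.div
    (f.stronglyMeasurable.measurable.comp hφ)).indicator hA
  measurable_map := hφ

/-- The density is |g|^r / |f ∘ φ|^r on A. Changing variables by φ turns |g|^r dx into at most C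
|f|^r dx, and the factor |f|^r cancels. -/
theorem ratio_bound {f g : MeasFun 𝕜} {A : Set ℝ} (hA : MeasurableSet A) {φ : ℝ → ℝ}
    (hφ : Measurable φ) {r C : ℝ≥0∞} (hr : r ≠ ∞)
    (h : ((halfLine.restrict A).withDensity (absPow g r.toReal)).map φ ≤
      C • halfLine.withDensity (absPow f r.toReal)) : (ratio f g hA hφ).Bound r C := by
  rw [Bound, if_neg hr]
  intro u hu
  have hfm : Measurable (absPow f r.toReal) := f.stronglyMeasurable.measurable.enorm.pow_const _
  have hgm : Measurable (absPow g r.toReal) := g.stronglyMeasurable.measurable.enorm.pow_const _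
  have hum : Measurable fun y => u y / absPow f r.toReal y := hu.div hfm
  calc ∫⁻ x, (ratio f g hA hφ).density r x * u (φ x) ∂halfLine
      ≤ ∫⁻ x in A, absPow g r.toReal x * (u (φ x) / absPow f r.toReal (φ x)) ∂halfLine := by
        rw [← lintegral_indicator hA]
        refine lintegral_mono fun x => ?_
        rw [density]
        split_ifs with h0
        · simp
        · by_cases hx : x ∈ A
          · simp only [ratio, indicator_of_mem hx] at h0 ⊢
            have hf0 : f (φ x) ≠ 0 := fun hz => h0 (by rw [hz, div_zero])
            rw [div_eq_mul_inv, enorm_mul, enorm_inv hf0,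
              ENNReal.mul_rpow_of_nonneg _ _ ENNReal.toReal_nonneg, ENNReal.inv_rpow, absPow, absPow,
              div_eq_mul_inv, mul_assoc, mul_comm (u (φ x))]
          · exact absurd (indicator_of_notMem hx (fun x => g x / f (φ x))) h0
    _ = ∫⁻ x, u (φ x) / absPow f r.toReal (φ x)
          ∂((halfLine.restrict A).withDensity (absPow g r.toReal)) := by
        rw [lintegral_withDensity_eq_lintegral_mul _ hgm
          (g := fun x => u (φ x) / absPow f r.toReal (φ x)) (hum.comp hφ)]
        rfl
    _ = ∫⁻ y, u y / absPow f r.toReal y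
          ∂(((halfLine.restrict A).withDensity (absPow g r.toReal)).map φ) :=
        (lintegral_map hum hφ).symm
    _ ≤ ∫⁻ y, u y / absPow f r.toReal y ∂(C • halfLine.withDensity (absPow f r.toReal)) :=
        lintegral_mono' h le_rfl
    _ = C * ∫⁻ y, absPow f r.toReal y * (u y / absPow f r.toReal y) ∂halfLine := by
        rw [lintegral_smul_measure, lintegral_withDensity_eq_lintegral_mul _ hfm hum]
        rfl
    _ ≤ C * ∫⁻ y, u y ∂halfLine := by
        gcongr
        exact ENNReal.mul_div_le

end WeightedComp

/-! ### From majorization to transport -/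

section Transport

theorem setLIntegral_le_of_ne_zero {μ : Measure ℝ} {G : ℝ → ℝ≥0∞} {s t : Set ℝ}
    (hs : MeasurableSet s) (ht : MeasurableSet t) (h : ∀ x ∈ s, G x ≠ 0 → x ∈ t) :
    ∫⁻ x in s, G x ∂μ ≤ ∫⁻ x in t, G x ∂μ := by
  rw [← lintegral_indicator hs, ← lintegral_indicator ht]
  refine lintegral_mono fun x => ?_
  by_cases hx : x ∈ s
  · rw [indicator_of_mem hx]
    by_cases h0 : G x = 0
    · rw [h0]; exact zero_le
    · rw [indicator_of_mem (h x hx h0)]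
  · rw [indicator_of_notMem hx]; exact zero_le

theorem ofReal_two_zpow_add_one (k : ℤ) :
    ENNReal.ofReal ((2 : ℝ) ^ (k + 1)) = 2 * ENNReal.ofReal ((2 : ℝ) ^ k) := by
  rw [zpow_add_one₀ two_ne_zero, mul_comm, ENNReal.ofReal_mul zero_le_two, ENNReal.ofReal_ofNat]

theorem ae_of_ae_restrict_withDensity {G : ℝ → ℝ≥0∞} (hG : Measurable G) {A : Set ℝ}
    (hA : MeasurableSet A) {P : ℝ → Prop}
    (h : ∀ᵐ x ∂((halfLine.restrict A).withDensity G), P x) :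
    ∀ᵐ x ∂halfLine, x ∈ A → G x ≠ 0 → P x := by
  rw [ae_withDensity_iff hG, ae_restrict_iff' hA] at h
  exact h

/-- Head majorization yields a transport of the mass of `G` into the mass of `F` which essentially
increases the values, outside of a set on which `G` is dominated by values which `F` takes on a set
of infinite measure. -/
theorem HeadMajorized.exists_transport {G F : ℝ → ℝ≥0∞} (h : HeadMajorized G F)
    (hG : Measurable G) (hF : Measurable F) (hGt : ∀ x, G x ≠ ∞) (hFt : ∀ x, F x ≠ ∞)
    (hfin : ∃ t : ℝ, ∫⁻ x in {x | ENNReal.ofReal t ≤ F x}, F x ∂halfLine < ∞) :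
    ∃ A, MeasurableSet A ∧
      (∃ φ, Measurable φ ∧
        ((halfLine.restrict A).withDensity G).map φ ≤ (2 : ℝ≥0∞) • halfLine.withDensity F ∧
        ∀ᵐ x ∂halfLine, x ∈ A → G x ≤ 4 * F (φ x)) ∧
      (∃ φ, Measurable φ ∧ (halfLine.restrict Aᶜ).map φ ≤ halfLine ∧
        ∀ᵐ x ∂halfLine, x ∈ Aᶜ → G x ≤ 4 * F (φ x)) := by
  obtain ⟨κ, hκm, hκ⟩ := exists_dyadic_level hG
  obtain ⟨l, hlm, hl⟩ := exists_dyadic_level hF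
  have hG0 : MeasurableSet {x | G x = 0} := hG (measurableSet_singleton 0)
  have hF0 : MeasurableSet {x | F x = 0} := hF (measurableSet_singleton 0)
  have hFge : ∀ k : ℤ, MeasurableSet {x | ENNReal.ofReal ((2 : ℝ) ^ k) ≤ F x} := fun k =>
    measurableSet_le measurable_const hF
  have hGge : ∀ k : ℤ, MeasurableSet {x | ENNReal.ofReal ((2 : ℝ) ^ k) ≤ G x} := fun k =>
    measurableSet_le measurable_const hG
  have hpow : ∀ k : ℤ, ENNReal.ofReal ((2 : ℝ) ^ k) ≠ 0 := fun k => by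
    simp only [ne_eq, ENNReal.ofReal_eq_zero, not_le]; positivity
  have hFl : ∀ k x, ENNReal.ofReal ((2 : ℝ) ^ k) ≤ F x ↔ F x ≠ 0 ∧ k ≤ l x := fun k x => by
    refine ⟨fun hx => ?_, fun hx => (hl x hx.1 (hFt x) k).1 hx.2⟩
    have h0 : F x ≠ 0 := fun h0 => hpow k (by rw [h0] at hx; exact nonpos_iff_eq_zero.1 hx)
    exact ⟨h0, (hl x h0 (hFt x) k).2 hx⟩
  have hGlt : ∀ x, G x ≠ 0 → G x < ENNReal.ofReal ((2 : ℝ) ^ (κ x + 1)) := fun x hx => by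
    by_contra! hcon
    have := (hκ x hx (hGt x) (κ x + 1)).2 hcon
    omega
  -- D holds the levels above which F has finite mass, as the transport lemma requires. It is closed
  -- upwards, so its complement is empty or a lower ray.
  set D : Set ℤ := {k | ∫⁻ x in {x | ENNReal.ofReal ((2 : ℝ) ^ k) ≤ F x}, F x ∂halfLine < ∞}
  have hup : ∀ {j k : ℤ}, j ∈ D → j ≤ k → k ∈ D := fun {j k} hj hjk =>
    lt_of_le_of_lt (lintegral_mono_set fun x hx =>
      (ENNReal.ofReal_le_ofReal (zpow_le_zpow_right₀ one_le_two hjk)).trans hx) hj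
  have hne : D.Nonempty := by
    obtain ⟨t, ht⟩ := hfin
    obtain ⟨n, hn⟩ := pow_unbounded_of_one_lt t (one_lt_two (α := ℝ))
    refine ⟨n, lt_of_le_of_lt (lintegral_mono_set fun x hx => ?_) ht⟩
    refine le_trans (ENNReal.ofReal_le_ofReal ?_) hx
    rw [zpow_natCast]
    exact hn.le
  have hleast : ∀ k, k ∉ D → ∃ k' ∈ D, ∀ j, j ∈ D ↔ k' ≤ j := fun k hk => by
    obtain ⟨k', hk', hmin⟩ := Int.exists_least_of_bdd (P := fun j => j ∈ D)
      ⟨k, fun j hj => le_of_not_gt fun hlt => hk (hup hj hlt.le)⟩ hne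
    exact ⟨k', hk', fun j => ⟨hmin j, hup hk'⟩⟩
  -- Restricting an upper level set to levels in D only raises its threshold.
  have hcut : ∀ k, ∃ k' ∈ D, ∀ j, (k ≤ j ∧ j ∈ D) ↔ k' ≤ j := fun k => by
    by_cases hk : k ∈ D
    · exact ⟨k, hk, fun j => ⟨fun h => h.1, fun h => ⟨h, hup hk h⟩⟩⟩
    · obtain ⟨k', hk', hiff⟩ := hleast k hk
      refine ⟨k', hk', fun j => ⟨fun h => (hiff j).1 h.2, fun h => ⟨?_, (hiff j).2 h⟩⟩⟩
      by_contra! hlt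
      exact hk (hup ((hiff j).2 h) hlt.le)
  have hκD : MeasurableSet {x | κ x - 1 ∈ D} :=
    (measurable_from_top (f := fun k : ℤ => k - 1)).comp hκm (MeasurableSet.of_discrete (s := D))
  have hAm : MeasurableSet {x | G x = 0 ∨ κ x - 1 ∈ D} := hG0.union hκD
  have hBm : MeasurableSet {x | F x ≠ 0 ∧ l x ∈ D} :=
    hF0.compl.inter (hlm (MeasurableSet.of_discrete (s := D)))
  have hνeq : ∀ k, ∃ k' ∈ D, (∀ j, (k ≤ j ∧ j ∈ D) ↔ k' ≤ j) ∧
      ((2 : ℝ≥0∞) • (halfLine.restrict {x | F x ≠ 0 ∧ l x ∈ D}).withDensity F) {x | k ≤ l x} =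
      2 * ∫⁻ x in {x | ENNReal.ofReal ((2 : ℝ) ^ k') ≤ F x}, F x ∂halfLine := fun k => by
    obtain ⟨k', hk', hiff⟩ := hcut k
    have hm : MeasurableSet {x | k ≤ l x} := hlm (MeasurableSet.of_discrete (s := Ici k))
    refine ⟨k', hk', hiff, ?_⟩
    rw [Measure.smul_apply, withDensity_apply _ hm, Measure.restrict_restrict (μ := halfLine) hm,
      smul_eq_mul]
    congr 4
    ext x
    simp only [mem_inter_iff, mem_ofPred_eq, hFl, ← hiff]
    tauto
  refine ⟨{x | G x = 0 ∨ κ x - 1 ∈ D}, hAm, ?_, ?_⟩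
  · refine Exists.elim (exists_transport_of_levels
      (μ := (halfLine.restrict {x | G x = 0 ∨ κ x - 1 ∈ D}).withDensity G)
      (ν := (2 : ℝ≥0∞) • (halfLine.restrict {x | F x ≠ 0 ∧ l x ∈ D}).withDensity F)
      -- The shift by one matches the loss from 2a to a in `lintegral_ge_le`; together with rounding
      -- to powers of 2 it gives the factor 4.
      (κ := fun x => κ x - 1) (l := l)
      ((withDensity_absolutelyContinuous _ _).trans Measure.restrict_le_self.absolutelyContinuous)
      (((withDensity_absolutelyContinuous _ _).trans
        Measure.restrict_le_self.absolutelyContinuous).smul_left _)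
      ((measurable_from_top (f := fun k : ℤ => k - 1)).comp hκm) hlm (fun k => ?_) (fun k => ?_))
      fun φ ⟨hφm, hφ, hlev⟩ => ?_
    rotate_left 2
    · refine ⟨φ, hφm, hφ.trans ?_, ?_⟩
      · gcongr
        refine Measure.le_iff.2 fun s hs => ?_
        rw [withDensity_apply _ hs, withDensity_apply _ hs]
        exact lintegral_mono' (Measure.restrict_mono le_rfl Measure.restrict_le_self) le_rfl
      · have hFne : ∀ᵐ y ∂((2 : ℝ≥0∞) •
            (halfLine.restrict {x | F x ≠ 0 ∧ l x ∈ D}).withDensity F), F y ≠ 0 := by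
          refine Measure.ae_smul_measure ?_ _
          refine (withDensity_absolutelyContinuous _ _).ae_le ?_
          filter_upwards [ae_restrict_mem hBm] with y hy using hy.1
        have hFφ := ae_of_ae_map hφm.aemeasurable (ae_mono hφ hFne)
        filter_upwards [ae_of_ae_restrict_withDensity hG hAm hlev,
          ae_of_ae_restrict_withDensity hG hAm hFφ] with x h1 h2 hxA
        by_cases h0 : G x = 0
        · rw [h0]; exact zero_le
        have h3 := (hFl (κ x - 1) (φ x)).2 ⟨h2 hxA h0, h1 hxA h0⟩
        refine (hGlt x h0).le.trans ?_
        rw [show κ x + 1 = κ x - 1 + 1 + 1 by ring, ofReal_two_zpow_add_one,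
          ofReal_two_zpow_add_one, ← mul_assoc, show (2 : ℝ≥0∞) * 2 = 4 by norm_num]
        gcongr
    · obtain ⟨k', hk', hiff, hν⟩ := hνeq k
      have hm : MeasurableSet {x | k ≤ κ x - 1} :=
        (measurable_from_top (f := fun k : ℤ => k - 1)).comp hκm
          (MeasurableSet.of_discrete (s := Ici k))
      rw [hν, withDensity_apply _ hm, Measure.restrict_restrict (μ := halfLine) hm]
      refine le_trans (setLIntegral_le_of_ne_zero (hm.inter hAm) (hGge (k' + 1)) ?_) ?_
      · intro x hx h0
        have h1 := (hiff (κ x - 1)).1 ⟨hx.1, hx.2.resolve_left h0⟩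
        exact (hκ x h0 (hGt x) (k' + 1)).1 (by omega)
      · have := h.lintegral_ge_le hG hF (a := (2 : ℝ) ^ k') (by positivity)
        rw [zpow_add_one₀ two_ne_zero, mul_comm ((2 : ℝ) ^ k')]
        exact this
    · obtain ⟨k', hk', hiff, hν⟩ := hνeq k
      rw [hν]
      exact ENNReal.mul_ne_top ENNReal.ofNat_ne_top (ne_of_lt hk')
  · by_cases hD : ∀ k, k ∈ D
    · refine ⟨id, measurable_id, ?_, Eventually.of_forall fun x hx => ?_⟩
      · rw [Measure.map_id]
        exact Measure.restrict_le_self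
      · exact absurd (Or.inr (hD _)) hx
    · push Not at hD
      obtain ⟨k, hk⟩ := hD
      obtain ⟨k', hk', hiff⟩ := hleast k hk
      -- Here k' is the least element of D. The mass above 2^(k'-1) is infinite and that above 2^k'
      -- finite, so the values in between occupy infinite measure. The quantile function of Lebesgue
      -- measure on B then maps the whole half line to B preserving measure.
      set B := {x | ENNReal.ofReal ((2 : ℝ) ^ (k' - 1)) ≤ F x} with hB
      have hBm := hFge (k' - 1)
      have hBinf : halfLine B = ∞ := by
        by_contra hBt
        have hnot : k' - 1 ∉ D := fun hmem => by
          have := (hiff _).1 hmem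
          omega
        refine hnot (lt_of_le_of_lt (b := ENNReal.ofReal ((2 : ℝ) ^ k') * halfLine B +
          ∫⁻ x in {x | ENNReal.ofReal ((2 : ℝ) ^ k') ≤ F x}, F x ∂halfLine) ?_
          (ENNReal.add_lt_top.2
            ⟨ENNReal.mul_lt_top ENNReal.ofReal_lt_top (lt_top_iff_ne_top.2 hBt), hk'⟩))
        have hsub : B ⊆ (B ∩ {x | F x < ENNReal.ofReal ((2 : ℝ) ^ k')}) ∪
            {x | ENNReal.ofReal ((2 : ℝ) ^ k') ≤ F x} := fun x hx => by
          rcases lt_or_ge (F x) (ENNReal.ofReal ((2 : ℝ) ^ k')) with h1 | h1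
          · exact Or.inl ⟨hx, h1⟩
          · exact Or.inr h1
        refine (lintegral_mono_set hsub).trans ((lintegral_union_le _ _ _).trans ?_)
        gcongr
        calc ∫⁻ x in B ∩ {x | F x < ENNReal.ofReal ((2 : ℝ) ^ k')}, F x ∂halfLine
            ≤ ∫⁻ x in B ∩ {x | F x < ENNReal.ofReal ((2 : ℝ) ^ k')},
                ENNReal.ofReal ((2 : ℝ) ^ k') ∂halfLine :=
              setLIntegral_mono' (hBm.inter (measurableSet_lt hF measurable_const))
                fun x hx => le_of_lt hx.2
          _ ≤ _ := by
              rw [setLIntegral_const]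
              gcongr
              exact inter_subset_left
      have hIic : ∀ y, (halfLine.restrict B) (Iic y) ≠ ∞ := fun y => by
        refine ne_top_of_le_ne_top (b := volume (Ioc 0 y)) (by simp) ?_
        refine (Measure.restrict_le_self _).trans ?_
        rw [Measure.restrict_apply measurableSet_Iic]
        exact measure_mono fun x hx => ⟨hx.2, hx.1⟩
      have hset : {s : ℝ | 0 < s ∧ ENNReal.ofReal s < (halfLine.restrict B) univ} = Ioi 0 := by
        ext s
        rw [Measure.restrict_apply_univ (μ := halfLine), hBinf]
        simp
      have hmap := map_quantile_eq hIic
      rw [hset] at hmap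
      have hqm := measurable_quantile hIic
      refine ⟨quantile (halfLine.restrict B), hqm, ?_, ?_⟩
      · refine (Measure.map_mono Measure.restrict_le_self hqm).trans ?_
        rw [halfLine, hmap]
        exact Measure.restrict_le_self
      · have hae : ∀ᵐ y ∂(halfLine.restrict B), y ∈ B := ae_restrict_mem hBm
        rw [← hmap] at hae
        filter_upwards [ae_of_ae_map hqm.aemeasurable hae] with x hx hxA
        have h0 : G x ≠ 0 := fun h0 => hxA (Or.inl h0)
        have h1 : κ x - 1 ∉ D := fun h1 => hxA (Or.inr h1)
        rw [hiff, not_le] at h1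
        refine (hGlt x h0).le.trans ?_
        refine (ENNReal.ofReal_le_ofReal (zpow_le_zpow_right₀ one_le_two
          (show κ x + 1 ≤ k' - 1 + 1 + 1 by omega))).trans ?_
        rw [ofReal_two_zpow_add_one, ofReal_two_zpow_add_one, ← mul_assoc,
          show (2 : ℝ≥0∞) * 2 = 4 by norm_num]
        gcongr
        exact hx

/-- Tail majorization yields a transport of the mass of `G` into the mass of `F` which decreases
the values, outside of a set on which `G` can be transported into `F` by increasing the values. -/
theorem TailMajorized.exists_transport {G F : ℝ → ℝ≥0∞} (h : TailMajorized G F)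
    (hG : Measurable G) (hF : Measurable F) (hGt : ∀ x, G x ≠ ∞) (hFt : ∀ x, F x ≠ ∞)
    (hfin : ∀ t : ℝ, 0 < t → halfLine {x | ENNReal.ofReal t ≤ F x} < ∞)
    (hfin' : ∀ t : ℝ, ∫⁻ x in {x | F x < ENNReal.ofReal t}, F x ∂halfLine < ∞) :
    ∃ A, MeasurableSet A ∧
      (∃ φ, Measurable φ ∧
        ((halfLine.restrict A).withDensity G).map φ ≤ (4 : ℝ≥0∞) • halfLine.withDensity F ∧
        ∀ᵐ x ∂halfLine, x ∈ A → G x ≠ 0 → F (φ x) ≠ 0 ∧ F (φ x) ≤ G x) ∧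
      (∃ φ, Measurable φ ∧ (halfLine.restrict Aᶜ).map φ ≤ (2 : ℝ≥0∞) • halfLine ∧
        ∀ᵐ x ∂halfLine, x ∈ Aᶜ → G x ≤ 2 * F (φ x)) := by
  obtain ⟨κ, hκm, hκ⟩ := exists_dyadic_level hG
  obtain ⟨l, hlm, hl⟩ := exists_dyadic_level hF
  have hG0 : MeasurableSet {x | G x = 0} := hG (measurableSet_singleton 0)
  have hFlt' : ∀ x, F x ≠ 0 → ∀ k, F x < ENNReal.ofReal ((2 : ℝ) ^ k) ↔ l x < k := fun x hx k => by
    rw [← not_le, ← hl x hx (hFt x) k, not_le]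
  have hGlt' : ∀ x, G x ≠ 0 → ∀ k, G x < ENNReal.ofReal ((2 : ℝ) ^ k) ↔ κ x < k := fun x hx k => by
    rw [← not_le, ← hκ x hx (hGt x) k, not_le]
  have hFlt : ∀ k : ℤ, MeasurableSet {x | F x < ENNReal.ofReal ((2 : ℝ) ^ k)} := fun k =>
    measurableSet_lt hF measurable_const
  have hGlt : ∀ k : ℤ, MeasurableSet {x | G x < ENNReal.ofReal ((2 : ℝ) ^ k)} := fun k =>
    measurableSet_lt hG measurable_const
  have hF0 : MeasurableSet {x | F x ≠ 0} := (hF (measurableSet_singleton 0)).compl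
  have hpow : ∀ k : ℤ, ENNReal.ofReal ((2 : ℝ) ^ k) ≠ 0 := fun k => by
    simp only [ne_eq, ENNReal.ofReal_eq_zero, not_le]; positivity
  have hFl : ∀ k x, ENNReal.ofReal ((2 : ℝ) ^ k) ≤ F x ↔ F x ≠ 0 ∧ k ≤ l x := fun k x => by
    refine ⟨fun hx => ?_, fun hx => (hl x hx.1 (hFt x) k).1 hx.2⟩
    have h0 : F x ≠ 0 := fun h0 => hpow k (by rw [h0] at hx; exact nonpos_iff_eq_zero.1 hx)
    exact ⟨h0, (hl x h0 (hFt x) k).2 hx⟩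
  -- D holds the levels at which the first alternative of `lintegral_lt_le_or` is available; it need
  -- not be a ray.
  set D : Set ℤ := {k | ∫⁻ x in {x | G x < ENNReal.ofReal ((2 : ℝ) ^ (k + 1))}, G x ∂halfLine ≤
    4 * ∫⁻ x in {x | F x < ENNReal.ofReal ((2 : ℝ) ^ k)}, F x ∂halfLine} with hDdef
  have hAm : MeasurableSet {x | G x = 0 ∨ κ x ∈ D} :=
    hG0.union (hκm (MeasurableSet.of_discrete (s := D)))
  have hnotD : ∀ k, k ∉ D → halfLine {x | ENNReal.ofReal ((2 : ℝ) ^ k) ≤ G x} ≤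
      2 * halfLine {x | ENNReal.ofReal ((2 : ℝ) ^ k) ≤ F x} := fun k hk => by
    have := h.lintegral_lt_le_or hG hF (a := (2 : ℝ) ^ k) (by positivity)
    rw [mul_comm (2 : ℝ), ← zpow_add_one₀ two_ne_zero] at this
    exact this.resolve_left hk
  refine ⟨{x | G x = 0 ∨ κ x ∈ D}, hAm, ?_, ?_⟩
  · have hνeq : ∀ k : ℤ,
        ((4 : ℝ≥0∞) • (halfLine.restrict {x | F x ≠ 0}).withDensity F) {x | k ≤ -l x - 1} =
        4 * ∫⁻ x in {x | F x < ENNReal.ofReal ((2 : ℝ) ^ (-k))}, F x ∂halfLine := fun k => by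
      have hm : MeasurableSet {x | k ≤ -l x - 1} :=
        hlm (MeasurableSet.of_discrete (s := {j | k ≤ -j - 1}))
      rw [Measure.smul_apply, withDensity_apply _ hm, Measure.restrict_restrict (μ := halfLine) hm,
        smul_eq_mul]
      congr 1
      refine le_antisymm (setLIntegral_le_of_ne_zero (hm.inter hF0) (hFlt _) fun x hx h0 => ?_)
        (setLIntegral_le_of_ne_zero (hFlt _) (hm.inter hF0) fun x hx h0 => ⟨?_, h0⟩)
      · have h1 : k ≤ -l x - 1 := hx.1
        exact (hFlt' x h0 (-k)).2 (by omega)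
      · have h1 := (hFlt' x h0 (-k)).1 hx
        change k ≤ -l x - 1
        omega
    refine Exists.elim (exists_transport_of_levels
      (μ := (halfLine.restrict {x | G x = 0 ∨ κ x ∈ D}).withDensity G)
      (ν := (4 : ℝ≥0∞) • (halfLine.restrict {x | F x ≠ 0}).withDensity F)
      -- Levels are negated because mass must move to smaller values. The extra -1 makes the level
      -- drop strictly, so F (φ x) < 2^(κ x) ≤ G x with no constant lost, which is what yields |w| ≥
      -- 1.
      (κ := fun x => -κ x) (l := fun x => -l x - 1)
      ((withDensity_absolutelyContinuous _ _).trans Measure.restrict_le_self.absolutelyContinuous)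
      (((withDensity_absolutelyContinuous _ _).trans
        Measure.restrict_le_self.absolutelyContinuous).smul_left _)
      hκm.neg ((measurable_from_top (f := fun k : ℤ => -k - 1)).comp hlm)
      (fun k => ?_) (fun k => ?_))
      fun φ ⟨hφm, hφ, hlev⟩ => ?_
    rotate_left 2
    · refine ⟨φ, hφm, hφ.trans ?_, ?_⟩
      · gcongr
        refine Measure.le_iff.2 fun s hs => ?_
        rw [withDensity_apply _ hs, withDensity_apply _ hs]
        exact lintegral_mono' (Measure.restrict_mono le_rfl Measure.restrict_le_self) le_rfl
      · have hFne : ∀ᵐ y ∂((4 : ℝ≥0∞) • (halfLine.restrict {x | F x ≠ 0}).withDensity F),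
            F y ≠ 0 := by
          refine Measure.ae_smul_measure ?_ _
          refine (withDensity_absolutelyContinuous _ _).ae_le ?_
          filter_upwards [ae_restrict_mem hF0] with y hy using hy
        have hFφ := ae_of_ae_map hφm.aemeasurable (ae_mono hφ hFne)
        filter_upwards [ae_of_ae_restrict_withDensity hG hAm hlev,
          ae_of_ae_restrict_withDensity hG hAm hFφ] with x h1 h2 hxA h0
        refine ⟨h2 hxA h0, ?_⟩
        have h3 := h1 hxA h0
        exact ((hFlt' (φ x) (h2 hxA h0) (κ x)).2 (by omega)).le.trans
          ((hκ x h0 (hGt x) (κ x)).1 le_rfl)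
    · have hm : MeasurableSet {x | k ≤ -κ x} :=
        hκm (MeasurableSet.of_discrete (s := {j | k ≤ -j}))
      rw [hνeq, withDensity_apply _ hm, Measure.restrict_restrict (μ := halfLine) hm]
      by_cases hex : ∃ i, i ∈ D ∧ i ≤ -k
      · obtain ⟨i, ⟨hiD, hik⟩, hmax⟩ := Int.exists_greatest_of_bdd
          (P := fun i => i ∈ D ∧ i ≤ -k) ⟨-k, fun j hj => hj.2⟩ hex
        calc _ ≤ ∫⁻ x in {x | G x < ENNReal.ofReal ((2 : ℝ) ^ (i + 1))}, G x ∂halfLine := by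
              refine setLIntegral_le_of_ne_zero (hm.inter hAm) (hGlt _) fun x hx h0 => ?_
              have h1 : k ≤ -κ x := hx.1
              have h2 := hmax (κ x) ⟨hx.2.resolve_left h0, by omega⟩
              exact (hGlt' x h0 _).2 (by omega)
          _ ≤ _ := hiD
          _ ≤ _ := by
              gcongr 4 * ?_
              exact lintegral_mono_set fun x hx => lt_of_lt_of_le hx
                (ENNReal.ofReal_le_ofReal (zpow_le_zpow_right₀ one_le_two hik))
      · refine le_trans (setLIntegral_le_of_ne_zero (hm.inter hAm) MeasurableSet.empty
          fun x hx h0 => hex ⟨κ x, hx.2.resolve_left h0, ?_⟩) ?_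
        · have h1 : k ≤ -κ x := hx.1
          omega
        · simp
    · rw [hνeq]
      exact ENNReal.mul_ne_top ENNReal.ofNat_ne_top (hfin' _).ne
  · have hνeq : ∀ k : ℤ, ((2 : ℝ≥0∞) • halfLine.restrict {x | F x ≠ 0}) {x | k ≤ l x} =
        2 * halfLine {x | ENNReal.ofReal ((2 : ℝ) ^ k) ≤ F x} := fun k => by
      have hm : MeasurableSet {x | k ≤ l x} := hlm (MeasurableSet.of_discrete (s := Ici k))
      rw [Measure.smul_apply, Measure.restrict_apply (μ := halfLine) hm, smul_eq_mul]
      congr 2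
      ext x
      simp only [mem_inter_iff, mem_ofPred_eq, hFl]
      tauto
    refine Exists.elim (exists_transport_of_levels
      (μ := halfLine.restrict {x | G x = 0 ∨ κ x ∈ D}ᶜ)
      (ν := (2 : ℝ≥0∞) • halfLine.restrict {x | F x ≠ 0}) (κ := κ) (l := l)
      Measure.restrict_le_self.absolutelyContinuous
      (Measure.restrict_le_self.absolutelyContinuous.smul_left _) hκm hlm
      (fun k => ?_) (fun k => ?_))
      fun φ ⟨hφm, hφ, hlev⟩ => ?_
    rotate_left 2
    · refine ⟨φ, hφm, hφ.trans ?_, ?_⟩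
      · gcongr
        exact Measure.restrict_le_self
      · have hFne : ∀ᵐ y ∂((2 : ℝ≥0∞) • halfLine.restrict {x | F x ≠ 0}), F y ≠ 0 :=
          Measure.ae_smul_measure (ae_restrict_mem hF0) _
        have hFφ := ae_of_ae_map hφm.aemeasurable (ae_mono hφ hFne)
        filter_upwards [(ae_restrict_iff' hAm.compl).1 hlev,
          (ae_restrict_iff' hAm.compl).1 hFφ] with x h1 h2 hxA
        have h0 : G x ≠ 0 := fun h0 => hxA (Or.inl h0)
        refine ((hGlt' x h0 (κ x + 1)).2 (by omega)).le.trans ?_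
        rw [ofReal_two_zpow_add_one]
        gcongr
        exact (hFl _ _).2 ⟨h2 hxA, h1 hxA⟩
    · have hm : MeasurableSet {x | k ≤ κ x} := hκm (MeasurableSet.of_discrete (s := Ici k))
      rw [hνeq, Measure.restrict_apply (μ := halfLine) hm]
      by_cases hex : ∃ i, i ∉ D ∧ k ≤ i
      · obtain ⟨i, ⟨hiD, hik⟩, hmin⟩ := Int.exists_least_of_bdd
          (P := fun i => i ∉ D ∧ k ≤ i) ⟨k, fun j hj => hj.2⟩ hex
        calc _ ≤ halfLine {x | ENNReal.ofReal ((2 : ℝ) ^ i) ≤ G x} := by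
              refine measure_mono fun x hx => ?_
              have h0 : G x ≠ 0 := fun h0 => hx.2 (Or.inl h0)
              have h1 := hmin (κ x) ⟨fun hD => hx.2 (Or.inr hD), hx.1⟩
              exact (hκ x h0 (hGt x) i).1 h1
          _ ≤ _ := hnotD i hiD
          _ ≤ _ := by
              gcongr 2 * ?_
              exact measure_mono fun x hx => le_trans
                (ENNReal.ofReal_le_ofReal (zpow_le_zpow_right₀ one_le_two hik)) hx
      · refine le_trans (measure_mono (t := ∅) fun x hx =>
          hex ⟨κ x, fun hD => hx.2 (Or.inr hD), hx.1⟩) ?_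
        simp
    · rw [hνeq]
      exact ENNReal.mul_ne_top ENNReal.ofNat_ne_top (hfin _ (by positivity)).ne

end Transport

/-! ### Bounds for the pieces of g and conclusion -/

namespace QuasiBanachFunctionSpace

variable {𝕜 : Type*} [RCLike 𝕜]

/-- The product of a function with the indicator function of a set. -/
noncomputable def cut (g : MeasFun 𝕜) {A : Set ℝ} (hA : MeasurableSet A) : MeasFun 𝕜 :=
  AEEqFun.mk (A.indicator g) (g.stronglyMeasurable.indicator hA).aestronglyMeasurable

theorem cut_add_cut_compl (g : MeasFun 𝕜) {A : Set ℝ} (hA : MeasurableSet A) :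
    cut g hA + cut g hA.compl = g := by
  refine AEEqFun.ext ?_
  filter_upwards [AEEqFun.coeFn_add (cut g hA) (cut g hA.compl),
    AEEqFun.coeFn_mk (A.indicator g) (g.stronglyMeasurable.indicator hA).aestronglyMeasurable,
    AEEqFun.coeFn_mk (Aᶜ.indicator g)
      (g.stronglyMeasurable.indicator hA.compl).aestronglyMeasurable] with x h1 h2 h3
  rw [h1, Pi.add_apply, cut, cut, h2, h3, indicator_self_add_compl_apply]

theorem ratio_apply_eq_cut {f g : MeasFun 𝕜} {A A' : Set ℝ} (hA : MeasurableSet A)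
    (hA' : MeasurableSet A') (hsub : A' ⊆ A) {φ : ℝ → ℝ} (hφ : Measurable φ)
    (h : ∀ᵐ x ∂halfLine, x ∈ A → g x ≠ 0 → x ∈ A' ∧ f (φ x) ≠ 0) :
    (WeightedComp.ratio f g hA' hφ).apply f = cut g hA := by
  refine AEEqFun.ext ?_
  filter_upwards [(WeightedComp.ratio f g hA' hφ).coeFn_apply f, h,
    AEEqFun.coeFn_mk (A.indicator g) (g.stronglyMeasurable.indicator hA).aestronglyMeasurable]
    with x h1 h2 h3
  rw [h1, cut, h3]
  simp only [WeightedComp.ratio]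
  by_cases hx : x ∈ A
  · rw [indicator_of_mem hx]
    by_cases hg : g x = 0
    · by_cases hx' : x ∈ A' <;> simp [hg, hx']
    · rw [indicator_of_mem (h2 hx hg).1, div_mul_cancel₀ _ (h2 hx hg).2]
  · rw [indicator_of_notMem hx, indicator_of_notMem (fun hx' => hx (hsub hx')), zero_mul]

theorem map_restrict_withDensity_mono {G : ℝ → ℝ≥0∞} {A A' : Set ℝ}
    (hsub : A' ⊆ A) {φ : ℝ → ℝ} (hφ : Measurable φ) :
    ((halfLine.restrict A').withDensity G).map φ ≤ ((halfLine.restrict A).withDensity G).map φ := by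
  refine Measure.map_mono (Measure.le_iff.2 fun s hs => ?_) hφ
  rw [withDensity_apply _ hs, withDensity_apply _ hs]
  exact lintegral_mono'
    (Measure.restrict_mono le_rfl (Measure.restrict_mono hsub le_rfl)) le_rfl

variable (E : QuasiBanachFunctionSpace 𝕜)

/-- A transport at an exponent r ≤ p with weight bounded by M bounds the ratio operator on both ends
of the couple. It serves with r = p and with r = 0. -/
theorem exists_bound_cut_of_le {p q r C M : ℝ≥0∞} (hpq : p < q)
    (hE : IsInterpolationSpace (LSpace 𝕜 p) (LSpace 𝕜 q) E.toSizedSpace) (hrp : r ≤ p)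
    (hC : C ≠ ∞) (hM : M ≠ ∞) (hM0 : M ≠ 0) :
    ∃ K : ℝ, 0 < K ∧ ∀ f ∈ E.carrier, ∀ g : MeasFun 𝕜, ∀ (A : Set ℝ) (hA : MeasurableSet A)
      (φ : ℝ → ℝ), Measurable φ →
      ((halfLine.restrict A).withDensity (absPow g r.toReal)).map φ ≤
        C • halfLine.withDensity (absPow f r.toReal) →
      (∀ᵐ x ∂halfLine, x ∈ A → ‖g x‖ₑ ≤ M * ‖f (φ x)‖ₑ) →
      cut g hA ∈ E.carrier ∧ E.size (cut g hA) ≤ K * E.size f := by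
  have hr : r ≠ ∞ := ne_top_of_le_ne_top hpq.ne_top hrp
  -- For q = ∞ the exponent `q.toReal - r.toReal` is 0 - r and may be negative, hence the need for M
  -- ≠ 0.
  have hpow : ∀ s : ℝ, max M (M ^ s * C) ≠ ∞ := fun s =>
    (max_lt hM.lt_top (ENNReal.mul_lt_top (ENNReal.rpow_ne_top_of_ne_zero hM0 hM).lt_top
      hC.lt_top)).ne
  obtain ⟨K, hK0, hK⟩ := E.exists_uniform_bound (C := max (max M (M ^ (p.toReal - r.toReal) * C))
    (max M (M ^ (q.toReal - r.toReal) * C))) hpq.ne_top hE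
    (max_lt (hpow _).lt_top (hpow _).lt_top).ne
  refine ⟨K, hK0, fun f hf g A hA φ hφ hmap hle => ?_⟩
  -- The weight bound has to hold at every point, so the exceptional null set is removed from A.
  have hA' : MeasurableSet (A ∩ {x | ‖g x‖ₑ ≤ M * ‖f (φ x)‖ₑ}) :=
    hA.inter (measurableSet_le g.stronglyMeasurable.measurable.enorm
      ((f.stronglyMeasurable.measurable.comp hφ).enorm.const_mul _))
  have hb := WeightedComp.ratio_bound hA' hφ hr
    ((map_restrict_withDensity_mono inter_subset_left hφ).trans hmap)
  have hw : ∀ x, ‖(WeightedComp.ratio f g hA' hφ).weight x‖ₑ ≤ M := fun x => by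
    simp only [WeightedComp.ratio]
    by_cases hx : x ∈ A ∩ {x | ‖g x‖ₑ ≤ M * ‖f (φ x)‖ₑ}
    · rw [indicator_of_mem hx]
      by_cases h0 : f (φ x) = 0
      · simp [h0]
      · rw [div_eq_mul_inv, enorm_mul, enorm_inv h0, ← div_eq_mul_inv]
        exact ENNReal.div_le_of_le_mul hx.2
    · rw [indicator_of_notMem hx]
      simp
  have := hK _ ((hb.of_le_exponent hr hrp hw).mono (le_max_left _ _))
    ((hb.of_le_exponent hr (hrp.trans hpq.le) hw).mono (le_max_right _ _)) f hf
  rwa [ratio_apply_eq_cut hA hA' inter_subset_left hφ] at this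
  filter_upwards [hle] with x hx hxA hg
  refine ⟨⟨hxA, hx hxA⟩, fun h0 => hg ?_⟩
  have := hx hxA
  rw [h0, enorm_zero, mul_zero, nonpos_iff_eq_zero, enorm_eq_zero] at this
  exact this

/-- The transport gives the bound at q; since the weight is at least 1 on its support, the bound at
p follows with the same constant. -/
theorem exists_bound_cut_of_ge {p q C : ℝ≥0∞} (hpq : p < q) (hq : q ≠ ∞)
    (hE : IsInterpolationSpace (LSpace 𝕜 p) (LSpace 𝕜 q) E.toSizedSpace) (hC : C ≠ ∞) :
    ∃ K : ℝ, 0 < K ∧ ∀ f ∈ E.carrier, ∀ g : MeasFun 𝕜, ∀ (A : Set ℝ) (hA : MeasurableSet A)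
      (φ : ℝ → ℝ), Measurable φ →
      ((halfLine.restrict A).withDensity (absPow g q.toReal)).map φ ≤
        C • halfLine.withDensity (absPow f q.toReal) →
      (∀ᵐ x ∂halfLine, x ∈ A → g x ≠ 0 → f (φ x) ≠ 0 ∧ ‖f (φ x)‖ₑ ≤ ‖g x‖ₑ) →
      cut g hA ∈ E.carrier ∧ E.size (cut g hA) ≤ K * E.size f := by
  obtain ⟨K, hK0, hK⟩ := E.exists_uniform_bound hpq.ne_top hE hC
  refine ⟨K, hK0, fun f hf g A hA φ hφ hmap hle => ?_⟩
  have hA' : MeasurableSet (A ∩ {x | ‖f (φ x)‖ₑ ≤ ‖g x‖ₑ}) :=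
    hA.inter (measurableSet_le (f.stronglyMeasurable.measurable.comp hφ).enorm
      g.stronglyMeasurable.measurable.enorm)
  have hb := WeightedComp.ratio_bound hA' hφ hq
    ((map_restrict_withDensity_mono inter_subset_left hφ).trans hmap)
  have hw : ∀ x, (WeightedComp.ratio f g hA' hφ).weight x ≠ 0 →
      1 ≤ ‖(WeightedComp.ratio f g hA' hφ).weight x‖ₑ := fun x => by
    simp only [WeightedComp.ratio]
    intro hne
    have hx : x ∈ A ∩ {x | ‖f (φ x)‖ₑ ≤ ‖g x‖ₑ} := by
      by_contra hx
      exact hne (indicator_of_notMem hx _)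
    rw [indicator_of_mem hx] at hne ⊢
    have h0 : f (φ x) ≠ 0 := fun h0 => hne (by rw [h0, div_zero])
    rw [div_eq_mul_inv, enorm_mul, enorm_inv h0, ← div_eq_mul_inv,
      ENNReal.le_div_iff_mul_le (Or.inl (by simpa using h0)) (Or.inl enorm_ne_top), one_mul]
    exact hx.2
  have := hK _ (hb.of_ge_exponent hq hpq.le hw) hb f hf
  rwa [ratio_apply_eq_cut hA hA' inter_subset_left hφ] at this
  filter_upwards [hle] with x hx hxA hg
  exact ⟨⟨hxA, (hx hxA hg).2⟩, (hx hxA hg).1⟩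

theorem enorm_le_of_rpow_le {r : ℝ} (hr : 0 < r) {a b c : ℝ≥0∞} (h : a ^ r ≤ c * b ^ r) :
    a ≤ c ^ r⁻¹ * b := by
  rw [← ENNReal.rpow_le_rpow_iff hr, ENNReal.mul_rpow_of_nonneg _ _ hr.le,
    ENNReal.rpow_inv_rpow hr.ne']
  exact h

/-- At exponent 0 `absPow` is identically 1, even on the zero set, so a transport of Lebesgue
measure is a transport at exponent 0. -/
theorem map_restrict_le_smul_withDensity_zero {f g : MeasFun 𝕜} {A : Set ℝ} {φ : ℝ → ℝ}
    {C : ℝ≥0∞} (h : (halfLine.restrict A).map φ ≤ C • halfLine) :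
    ((halfLine.restrict A).withDensity (absPow g (0 : ℝ≥0∞).toReal)).map φ ≤
      C • halfLine.withDensity (absPow f (0 : ℝ≥0∞).toReal) := by
  have h1 : ∀ u : MeasFun 𝕜, absPow u (0 : ℝ≥0∞).toReal = 1 := fun u => by
    ext x
    simp [absPow]
  rw [h1, h1, withDensity_one, withDensity_one]
  exact h

theorem measurable_absPow (f : MeasFun 𝕜) (r : ℝ) : Measurable (absPow f r) :=
  f.stronglyMeasurable.measurable.enorm.pow_const _

theorem absPow_ne_top (f : MeasFun 𝕜) {r : ℝ} (hr : 0 ≤ r) (x : ℝ) : absPow f r x ≠ ∞ :=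
  ENNReal.rpow_ne_top_of_nonneg hr enorm_ne_top

theorem mem_and_size_le_of_cut {K : ℝ} (hK : 1 ≤ K)
    (htri : ∀ f ∈ E.carrier, ∀ g ∈ E.carrier, E.size (f + g) ≤ K * (E.size f + E.size g))
    {f g : MeasFun 𝕜} {A : Set ℝ} (hA : MeasurableSet A) {K₁ K₂ : ℝ}
    (h₁ : cut g hA ∈ E.carrier ∧ E.size (cut g hA) ≤ K₁ * E.size f)
    (h₂ : cut g hA.compl ∈ E.carrier ∧ E.size (cut g hA.compl) ≤ K₂ * E.size f) :
    g ∈ E.carrier ∧ E.size g ≤ K * (K₁ + K₂) * E.size f := by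
  have hsum := cut_add_cut_compl g hA
  refine ⟨hsum ▸ E.carrier.add_mem h₁.1 h₂.1, ?_⟩
  conv_lhs => rw [← hsum]
  refine (htri _ h₁.1 _ h₂.1).trans ?_
  rw [mul_assoc, add_mul]
  exact mul_le_mul_of_nonneg_left (add_le_add h₁.2 h₂.2) (by linarith)

/-- Interpolation spaces for `(L_p, L_q)` are monotone with respect to head majorization of
`p`-th powers. -/
theorem exists_bound_of_headMajorized {p q : ℝ≥0∞} (hpq : p < q) (hp : p ≠ 0)
    (hE : IsInterpolationSpace (LSpace 𝕜 p) (LSpace 𝕜 q) E.toSizedSpace) :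
    ∃ c : ℝ, 0 < c ∧ ∀ f ∈ E.carrier, ∀ g : MeasFun 𝕜,
      HeadMajorized (absPow g p.toReal) (absPow f p.toReal) →
        g ∈ E.carrier ∧ E.size g ≤ c * E.size f := by
  have hp0 : 0 < p.toReal := ENNReal.toReal_pos hp hpq.ne_top
  have hM0 : (4 : ℝ≥0∞) ^ p.toReal⁻¹ ≠ 0 := (ENNReal.rpow_pos (by simp) (by simp)).ne'
  have hMt : (4 : ℝ≥0∞) ^ p.toReal⁻¹ ≠ ∞ :=
    ENNReal.rpow_ne_top_of_nonneg (by positivity) (by simp)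
  obtain ⟨K, hK, htri⟩ := E.exists_quasi_triangle
  obtain ⟨K₁, hK₁, h₁⟩ := E.exists_bound_cut_of_le (C := 2) hpq hE le_rfl (by simp) hMt hM0
  obtain ⟨K₂, hK₂, h₂⟩ := E.exists_bound_cut_of_le (C := 1) hpq hE zero_le (by simp) hMt hM0
  refine ⟨K * (K₁ + K₂), by positivity, fun f hf g hmaj => ?_⟩
  obtain ⟨A, hA, ⟨φ, hφm, hφ, hφle⟩, ⟨ψ, hψm, hψ, hψle⟩⟩ := hmaj.exists_transport
    (measurable_absPow g _) (measurable_absPow f _) (absPow_ne_top g hp0.le)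
    (absPow_ne_top f hp0.le) (exists_lintegral_absPow_ge_lt_top hpq hp (hE.2.1 hf))
  refine E.mem_and_size_le_of_cut hK htri hA (h₁ f hf g A hA φ hφm hφ ?_)
    (h₂ f hf g _ hA.compl ψ hψm (map_restrict_le_smul_withDensity_zero (by rwa [one_smul])) ?_)
  · filter_upwards [hφle] with x hx hxA using enorm_le_of_rpow_le hp0 (hx hxA)
  · filter_upwards [hψle] with x hx hxA using enorm_le_of_rpow_le hp0 (hx hxA)

/-- Interpolation spaces for `(L_p, L_q)` are monotone with respect to tail majorization of
`q`-th powers. -/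
theorem exists_bound_of_tailMajorized {p q : ℝ≥0∞} (hpq : p < q) (hq : q ≠ ∞)
    (hE : IsInterpolationSpace (LSpace 𝕜 p) (LSpace 𝕜 q) E.toSizedSpace) :
    ∃ c : ℝ, 0 < c ∧ ∀ f ∈ E.carrier, ∀ g : MeasFun 𝕜,
      TailMajorized (absPow g q.toReal) (absPow f q.toReal) →
        g ∈ E.carrier ∧ E.size g ≤ c * E.size f := by
  have hq0 : 0 < q.toReal := ENNReal.toReal_pos hpq.ne_bot hq
  have hM0 : (2 : ℝ≥0∞) ^ q.toReal⁻¹ ≠ 0 := (ENNReal.rpow_pos (by simp) (by simp)).ne'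
  have hMt : (2 : ℝ≥0∞) ^ q.toReal⁻¹ ≠ ∞ :=
    ENNReal.rpow_ne_top_of_nonneg (by positivity) (by simp)
  obtain ⟨K, hK, htri⟩ := E.exists_quasi_triangle
  obtain ⟨K₁, hK₁, h₁⟩ := E.exists_bound_cut_of_ge (C := 4) hpq hq hE (by simp)
  obtain ⟨K₂, hK₂, h₂⟩ := E.exists_bound_cut_of_le (C := 2) hpq hE zero_le (by simp) hMt hM0
  refine ⟨K * (K₁ + K₂), by positivity, fun f hf g hmaj => ?_⟩
  obtain ⟨A, hA, ⟨φ, hφm, hφ, hφle⟩, ⟨ψ, hψm, hψ, hψle⟩⟩ := hmaj.exists_transport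
    (measurable_absPow g _) (measurable_absPow f _) (absPow_ne_top g hq0.le)
    (absPow_ne_top f hq0.le) (fun t ht => measure_absPow_ge_lt_top hpq hq (hE.2.1 hf) ht)
    (lintegral_absPow_lt_lt_top hpq hq (hE.2.1 hf))
  have hzero : ∀ (u : MeasFun 𝕜) (x : ℝ), absPow u q.toReal x = 0 ↔ u x = 0 := fun u x => by
    rw [absPow, ENNReal.rpow_eq_zero_iff_of_pos hq0, enorm_eq_zero]
  refine E.mem_and_size_le_of_cut hK htri hA (h₁ f hf g A hA φ hφm hφ ?_)
    (h₂ f hf g _ hA.compl ψ hψm (map_restrict_le_smul_withDensity_zero hψ) ?_)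
  · filter_upwards [hφle] with x hx hxA hg
    have h3 := hx hxA (by rwa [Ne, hzero])
    exact ⟨by simpa [hzero] using h3.1, (ENNReal.rpow_le_rpow_iff hq0).1 h3.2⟩
  · filter_upwards [hψle] with x hx hxA using enorm_le_of_rpow_le hq0 (hx hxA)

end QuasiBanachFunctionSpace

theorem mainTheorem4 {𝕜 : Type*} [RCLike 𝕜] (p q : ℝ≥0∞) (hpq : p < q)
    (E : QuasiBanachFunctionSpace 𝕜)
    (hE : IsInterpolationSpace (LSpace 𝕜 p) (LSpace 𝕜 q) E.toSizedSpace) :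
    ∃ cp cq : ℝ, 0 < cp ∧ 0 < cq ∧
      (p ≠ 0 → ∀ f ∈ E.carrier, ∀ g ∈ (LSpace 𝕜 p).carrier ⊔ (LSpace 𝕜 ∞).carrier,
        HeadMajorized (absPow g p.toReal) (absPow f p.toReal) →
          g ∈ E.carrier ∧ E.size g ≤ cp * E.size f) ∧
      (q ≠ ∞ → ∀ f ∈ E.carrier, ∀ g ∈ (LSpace 𝕜 0).carrier ⊔ (LSpace 𝕜 q).carrier,
        TailMajorized (absPow g q.toReal) (absPow f q.toReal) →
          g ∈ E.carrier ∧ E.size g ≤ cq * E.size f) := by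
  have hhead : ∃ c : ℝ, 0 < c ∧ (p ≠ 0 → ∀ f ∈ E.carrier, ∀ g : MeasFun 𝕜,
      HeadMajorized (absPow g p.toReal) (absPow f p.toReal) →
        g ∈ E.carrier ∧ E.size g ≤ c * E.size f) := by
    by_cases hp : p = 0
    · exact ⟨1, one_pos, fun h => absurd hp h⟩
    · obtain ⟨c, hc, h⟩ := E.exists_bound_of_headMajorized hpq hp hE
      exact ⟨c, hc, fun _ => h⟩
  have htail : ∃ c : ℝ, 0 < c ∧ (q ≠ ∞ → ∀ f ∈ E.carrier, ∀ g : MeasFun 𝕜,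
      TailMajorized (absPow g q.toReal) (absPow f q.toReal) →
        g ∈ E.carrier ∧ E.size g ≤ c * E.size f) := by
    by_cases hq : q = ∞
    · exact ⟨1, one_pos, fun h => absurd hq h⟩
    · obtain ⟨c, hc, h⟩ := E.exists_bound_of_tailMajorized hpq hq hE
      exact ⟨c, hc, fun _ => h⟩
  obtain ⟨cp, hcp, hp⟩ := hhead
  obtain ⟨cq, hcq, hq⟩ := htail
  exact ⟨cp, cq, hcp, hcq, fun h0 f hf g _ => hp h0 f hf g, fun h0 f hf g _ => hq h0 f hf g⟩
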